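/- Let $V,H$ be real Hilbert spaces with $V$ continuously, densely and compactly embedded in $H$, so that $V\hookrightarrow H\cong H^*\hookrightarrow V^*$. Let $a\colon V\times V\to\mathbb R$ be a continuous bilinear form satisfying, for some $\alpha_0>0$ and $\omega_0\ge 0$, the Gårding inequality $a(v,v)+\omega_0\|v\|_H^2\ge\alpha_0\|v\|_V^2$ for all $v\in V$, and let $A\colon V\to V^*$, $\langle Ay,v\rangle=a(y,v)$. Let $(\omega,\varrho)$ be a measure space, $B\colon L^2(\omega)\to V^*$ linear and continuous, $y_0,y_d\in H$, $\delta_0>0$, and let $u_a,u_b\in L^\infty(\omega)$ with $u_a<u_b$ a.e. Put $$U_{ad}=\{u\in L^2(\omega): u_a\le u\le u_b \text{ a.e.}\},\qquad U_{ad}(0,T)=\{u\in L^2((0,T);L^2(\omega)): u(t)\in U_{ad}\text{ for a.e. }t\},$$ and assume that $U_{ad}$ is bounded in $L^2(\omega)$ (this is automatic if $\varrho(\omega)<\infty$). For $T>0$, $u\in U_{ad}(0,T)$ and $x\in H$ let $y[u,x]\in W(0,T)=H^1((0,T);V^*)\cap L^2((0,T);V)\hookrightarrow C([0,T];H)$ be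 the solution of $\partial_t y+Ay=Bu$ in $(0,T)$, $y(0)=x$. For $\delta\ge 0$ let $$T(\delta)=\inf\{T>0:\ \exists\,u\in U_{ad}(0,T),\ \|y[u,y_0](T)-y_d\|_H\le\delta_0+\delta\}\in[0,\infty].$$ Assume that the set on the right-hand side is non-empty for $\delta=0$ and that $\|y_0-y_d\|_H>\delta_0$, and put $\delta^\bullet=\|y_0-y_d\|_H-\delta_0$. A trajectory $y^\delta=y[u,y_0]$ on $[0,T(\delta)]$ with $u\in U_{ad}(0,T(\delta))$ is called optimal for $\delta$ if $\|y^\delta(T(\delta))-y_d\|_H\le\delta_0+\delta$; if $T(\delta)=0$ (which for $\delta\in[0,\delta^\bullet]$ is possible only for $\delta=\delta^\bullet$), this is understood as $y^\delta(T(\delta))=y_0$. Suppose that the following controllability condition holds: for every $\delta\in(0,\delta^\bullet]$ for which there is an optimal trajectory, there is an optimal trajectory $y^\delta$, a time $T'>0$ and a control $u\in U_{ad}(0,T')$ such that $$\|y[u,y^\delta(T(\delta))](t)-y_d\|_H<\delta_0+\delta\quad\text{for all }t\in(0,T'].$$ (In particular, this holds if such $T'$ and $u$ exist for every optimal trajectory.)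 Then $T(\cdot)$ is left-continuous: for every $\delta>0$ one has $T(\delta')\to T(\delta)$ as $\delta'\to\delta$ with $0\le\delta'\le\delta$. -/

import Mathlib

open MeasureTheory Set
open scoped ENNReal

/-- The data of the time-optimal control problem: the embedding `ι : V → H` of the Gelfand triple,
the bilinear form `a` (with `⟨A y, v⟩ = a y v`), the control operator `B : L²(ω, ϱ) → V*`,
the control bounds `ua`, `ub`, the initial state, the desired state and the target radius. -/
structure ControlProblem (V H : Type*)
    [NormedAddCommGroup V] [InnerProductSpace ℝ V] [NormedAddCommGroup H] [InnerProductSpace ℝ H]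
    {ω : Type*} [MeasurableSpace ω] (ϱ : Measure ω) where
  ι : V →L[ℝ] H
  a : V →L[ℝ] V →L[ℝ] ℝ
  B : Lp ℝ 2 ϱ →L[ℝ] (V →L[ℝ] ℝ)
  ua : Lp ℝ ⊤ ϱ
  ub : Lp ℝ ⊤ ϱ
  y₀ : H
  yd : H
  δ₀ : ℝ

/-- `g` is the weak (distributional) derivative of `f` on the interval `(0, T)`. -/
def HasWeakDerivOn {E : Type*} [NormedAddCommGroup E] [NormedSpace ℝ E]
    (T : ℝ) (f g : ℝ → E) : Prop :=
  ∀ φ : ℝ → ℝ, ContDiff ℝ ((⊤ : ℕ∞) : WithTop ℕ∞) φ → HasCompactSupport φ →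
    tsupport φ ⊆ Ioo 0 T →
    ∫ t in Ioo 0 T, deriv φ t • f t = -∫ t in Ioo 0 T, φ t • g t

namespace ControlProblem

variable {V H : Type*}
    [NormedAddCommGroup V] [InnerProductSpace ℝ V] [NormedAddCommGroup H] [InnerProductSpace ℝ H]
    {ω : Type*} [MeasurableSpace ω] {ϱ : Measure ω} (P : ControlProblem V H ϱ)

/-- The embedding `H ≅ H* → V*`, `h ↦ (h, ι ·)_H`. -/
noncomputable def toDual (h : H) : V →L[ℝ] ℝ := (innerSL ℝ h).comp P.ι

/-- The set `U_ad` of admissible control values in `L²(ω)`. -/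
def Uad : Set (Lp ℝ 2 ϱ) := {u | ∀ᵐ x ∂ϱ, P.ua x ≤ u x ∧ u x ≤ P.ub x}

/-- `u ∈ U_ad(0, T)`: `u` is in `L²((0,T); L²(ω))` and `u(t) ∈ U_ad` for a.e. `t ∈ (0,T)`. -/
def IsAdmissible (T : ℝ) (u : ℝ → Lp ℝ 2 ϱ) : Prop :=
  MemLp u 2 (volume.restrict (Ioo 0 T)) ∧ ∀ᵐ t ∂volume.restrict (Ioo 0 T), u t ∈ P.Uad

/-- `y ∈ W(0,T) = H¹((0,T); V*) ∩ L²((0,T); V)` with `∂ₜ y = y'`. Here `y` is the representative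
that is continuous from `[0,T]` to `H` (the one which defines the traces `y(t)`), and `w` is `y`
regarded as a `V`-valued function. -/
structure MemW (T : ℝ) (y : ℝ → H) (w : ℝ → V) (y' : ℝ → (V →L[ℝ] ℝ)) : Prop where
  continuousOn : ContinuousOn y (Icc 0 T)
  memLp : MemLp w 2 (volume.restrict (Ioo 0 T))
  ae_eq : ∀ᵐ t ∂volume.restrict (Ioo 0 T), P.ι (w t) = y t
  memLp_deriv : MemLp y' 2 (volume.restrict (Ioo 0 T))
  hasWeakDeriv : HasWeakDerivOn T (fun t => P.toDual (y t)) y'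

/-- `y = y[u, x]` on `[0, T]`: `y ∈ W(0,T)`, `∂ₜ y + A y = B u` in `(0,T)`, `y(0) = x`. -/
def IsState (T : ℝ) (u : ℝ → Lp ℝ 2 ϱ) (x : H) (y : ℝ → H) : Prop :=
  ∃ (w : ℝ → V) (y' : ℝ → (V →L[ℝ] ℝ)), P.MemW T y w y' ∧
    (∀ᵐ t ∂volume.restrict (Ioo 0 T), y' t + P.a (w t) = P.B (u t)) ∧ y 0 = x

/-- `y` is the trajectory on `[0, T]`, starting at `y₀`, of some control in `U_ad(0,T)`, and it
satisfies the terminal constraint of the problem `P_δ`. -/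
def Reaches (δ T : ℝ) (y : ℝ → H) : Prop :=
  (∃ u : ℝ → Lp ℝ 2 ϱ, P.IsAdmissible T u ∧ P.IsState T u P.y₀ y) ∧
    ‖y T - P.yd‖ ≤ P.δ₀ + δ

/-- The value function `T(δ) = inf P_δ`, with values in `[0, ∞]`; the infimum is over times
`T > 0`. -/
noncomputable def minTime (δ : ℝ) : ℝ≥0∞ :=
  ⨅ T ∈ {T : ℝ | 0 < T ∧ ∃ y, P.Reaches δ T y}, ENNReal.ofReal T

/-- `y` is an optimal trajectory of `P_δ` with `T = T(δ)`. The value `T(δ) = 0`, which occurs in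
`[0, δ•]` only at the end point `δ• = ‖y₀ - yd‖ - δ₀`, is allowed; then `y(T(δ)) = y₀`. -/
def IsOptimalTrajectory (δ T : ℝ) (y : ℝ → H) : Prop :=
  0 ≤ T ∧ ENNReal.ofReal T = P.minTime δ ∧ P.Reaches δ T y

/-- From `x`, some admissible control keeps the trajectory strictly inside the ball of radius
`δ₀ + δ` around `yd` for a positive time. -/
def CanEnter (δ : ℝ) (x : H) : Prop :=
  ∃ T' : ℝ, 0 < T' ∧ ∃ u : ℝ → Lp ℝ 2 ϱ, P.IsAdmissible T' u ∧
    ∃ z : ℝ → H, P.IsState T' u x z ∧ ∀ t ∈ Ioc 0 T', ‖z t - P.yd‖ < P.δ₀ + δ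

/-- The controllability condition. For each `δ ∈ (0, δ•]` it is only required for one optimal
trajectory. The premise means that existence of an optimal trajectory is not a part of the
condition. -/
def Controllability : Prop :=
  ∀ δ ∈ Ioc 0 (‖P.y₀ - P.yd‖ - P.δ₀),
    (∃ T y, P.IsOptimalTrajectory δ T y) →
      ∃ T y, P.IsOptimalTrajectory δ T y ∧ P.CanEnter δ (y T)

end ControlProblem

/-! Enlarging `δ` weakens the terminal constraint, so `minTime` is antitone, and left-continuity at
`δ` reduces to one claim: for every `b` above `minTime δ` there is `δ' < δ` with `minTime δ' < b`.
It suffices to exhibit an admissible trajectory lying strictly inside the ball of radius `δ₀ + δ` at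
some positive time before `b`; its distance to `yd` at that time defines `δ'`. If `δ` exceeds `δ•`,
the initial state is already in the open ball, and any admissible trajectory stays there for a short
time. If `δ ≤ δ•`, the controllability condition supplies an optimal trajectory that can be
continued into the open ball; concatenation gives strict entry at times arbitrarily close to the
minimal time. The analytic work is the existence of an optimal trajectory, which the controllability
condition presupposes. Take trajectories reaching the ball at times `S` decreasing to `T` and
restrict them to `[0, T]`. The Gårding inequality and Grönwall bound them in `L²(V)`, hence their
velocities in `L²(V*)`, so their states at `T` are close in `V*` to their endpoints at `S`. Those
endpoints lie in the ball and are carried along as a separate component. The resulting sets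
`almostReaching` of triples are convex, bounded, nonempty and decreasing as the tolerance shrinks.
Elements of almost minimal Hilbert norm form a Cauchy sequence by the parallelogram law, so strong
convergence replaces weak compactness. The energy identity makes the states converge uniformly in
`H`, the limit solves the state equation, and density of `V` identifies its endpoint with the limit
of the points in the ball. Two tools support this: the lemma of du Bois-Reymond, which turns the
weak equation into an integrated one, and the energy identity, proved with Steklov quotients.
Trajectories are only restricted, linearly combined, concatenated and passed to the limit, so no
solvability theory is needed. -/

open Filter Topology

/-! ### Weak derivatives on an interval and primitives. -/

section WeakDerivative

variable {E : Type*} [NormedAddCommGroup E] [NormedSpace ℝ E]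

/-- Integration by parts against the primitive of an integrable function. -/
theorem setIntegral_deriv_smul_primitive [CompleteSpace E] {T : ℝ} {φ : ℝ → ℝ}
    (hφ : ContDiff ℝ 1 φ) (hφT : φ T = 0) {g : ℝ → E} (hg : IntegrableOn g (Ioo 0 T)) :
    ∫ t in Ioo 0 T, deriv φ t • (∫ s in (0 : ℝ)..t, g s) = -∫ t in Ioo 0 T, φ t • g t := by
  have hdc : Continuous (deriv φ) := hφ.continuous_deriv le_rfl
  have hd : IntegrableOn (deriv φ) (Ioo 0 T) :=
    (hdc.integrableOn_Icc (a := 0) (b := T)).mono_set Ioo_subset_Icc_self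
  set μ := (volume : Measure ℝ).restrict (Ioo 0 T) with hμ
  -- Fubini on the triangle `s < t`: integrating over `t` first leaves `φ T - φ s = -φ s`.
  have hint : Integrable (Function.uncurry fun t s : ℝ =>
      (Iio t).indicator (fun s => deriv φ t • g s) s) (μ.prod μ) := by
    have h1 : Integrable (fun z : ℝ × ℝ => deriv φ z.1 • g z.2) (μ.prod μ) :=
      Integrable.smul_prod hd hg
    have h2 : MeasurableSet {z : ℝ × ℝ | z.2 < z.1} :=
      measurableSet_lt measurable_snd measurable_fst
    refine (h1.indicator h2).congr (Eventually.of_forall fun z => ?_)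
    simp [Function.uncurry, indicator]
  have h1 : ∀ t ∈ Ioo 0 T, deriv φ t • (∫ s in (0 : ℝ)..t, g s) =
      ∫ s, (Iio t).indicator (fun s => deriv φ t • g s) s ∂μ := by
    intro t ht
    have hs : Iio t ∩ Ioo 0 T = Ioo 0 t := by
      ext x; constructor
      · exact fun h => ⟨h.2.1, h.1⟩
      · exact fun h => ⟨h.2, h.1, h.2.trans ht.2⟩
    rw [integral_indicator measurableSet_Iio, integral_smul,
      intervalIntegral.integral_of_le ht.1.le, hμ, Measure.restrict_restrict measurableSet_Iio,
      hs, integral_Ioc_eq_integral_Ioo]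
  have h2 : ∀ s ∈ Ioo 0 T,
      ∫ t, (Iio t).indicator (fun s => deriv φ t • g s) s ∂μ = -(φ s • g s) := by
    intro s hs
    have hs' : Ioi s ∩ Ioo 0 T = Ioo s T := by
      ext x; constructor
      · exact fun h => ⟨h.1, h.2.2⟩
      · exact fun h => ⟨h.1, hs.1.trans h.1, h.2⟩
    have : ∀ t, (Iio t).indicator (fun s => deriv φ t • g s) s =
        (Ioi s).indicator (fun t => deriv φ t • g s) t := fun t => by simp [indicator]
    simp_rw [this]
    rw [integral_indicator measurableSet_Ioi, hμ, Measure.restrict_restrict measurableSet_Ioi,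
      hs', integral_smul_const, ← integral_Ioc_eq_integral_Ioo,
      ← intervalIntegral.integral_of_le hs.2.le,
      intervalIntegral.integral_deriv_eq_sub (fun x _ => hφ.differentiable one_ne_zero x)
        (hdc.intervalIntegrable _ _), hφT, zero_sub, neg_smul]
  rw [setIntegral_congr_fun measurableSet_Ioo h1, integral_integral_swap hint,
    setIntegral_congr_fun measurableSet_Ioo h2, integral_neg]

theorem setIntegral_deriv_eq_zero {T : ℝ} {φ : ℝ → ℝ} (hφ : ContDiff ℝ 1 φ)
    (hφ0 : φ 0 = 0) (hφT : φ T = 0) : ∫ t in Ioo 0 T, deriv φ t = 0 := by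
  rcases le_total 0 T with hT | hT
  · rw [← integral_Ioc_eq_integral_Ioo, ← intervalIntegral.integral_of_le hT,
      intervalIntegral.integral_deriv_eq_sub (fun x _ => hφ.differentiable one_ne_zero x)
        ((hφ.continuous_deriv le_rfl).intervalIntegrable _ _), hφ0, hφT, sub_zero]
  · simp [Ioo_eq_empty (not_lt.2 hT)]

theorem continuousOn_primitive_Icc {T : ℝ} {g : ℝ → E} (hg : IntegrableOn g (Ioo 0 T)) :
    ContinuousOn (fun t => ∫ s in (0 : ℝ)..t, g s) (Icc 0 T) := by
  have := intervalIntegral.continuousOn_primitive (a := 0) (b := T) (μ := volume) (f := g)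
    (by rwa [integrableOn_Icc_iff_integrableOn_Ioo])
  exact this.congr fun t ht => intervalIntegral.integral_of_le ht.1

/-- A primitive of an integrable function has that function as its weak derivative. -/
theorem hasWeakDerivOn_of_eq_primitive [CompleteSpace E] {T : ℝ} {f g : ℝ → E} {c : E}
    (hg : IntegrableOn g (Ioo 0 T))
    (hf : ∀ t ∈ Ioo 0 T, f t = c + ∫ s in (0 : ℝ)..t, g s) : HasWeakDerivOn T f g := by
  intro φ hφ _ hsupp
  have hφ1 : ContDiff ℝ 1 φ := hφ.of_le (by exact_mod_cast le_top)
  have h0 : ∀ x, x ∉ Ioo 0 T → φ x = 0 := fun x hx =>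
    image_eq_zero_of_notMem_tsupport fun h => hx (hsupp h)
  have hd : IntegrableOn (deriv φ) (Ioo 0 T) :=
    ((hφ1.continuous_deriv le_rfl).integrableOn_Icc (a := 0) (b := T)).mono_set
      Ioo_subset_Icc_self
  have hprim := continuousOn_primitive_Icc hg
  have hi : IntegrableOn (fun t => deriv φ t • (∫ s in (0 : ℝ)..t, g s)) (Ioo 0 T) :=
    ((((hφ1.continuous_deriv le_rfl).continuousOn).smul hprim).integrableOn_Icc).mono_set
      Ioo_subset_Icc_self
  rw [← setIntegral_deriv_smul_primitive hφ1 (h0 T (by simp)) hg,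
    setIntegral_congr_fun measurableSet_Ioo
      (fun t ht => by rw [hf t ht, smul_add] : EqOn _ (fun t => deriv φ t • c +
        deriv φ t • ∫ s in (0 : ℝ)..t, g s) _),
    integral_add (hd.smul_const c) hi, integral_smul_const,
    setIntegral_deriv_eq_zero hφ1 (h0 0 (by simp)) (h0 T (by simp)), zero_smul, zero_add]

/-- A smooth function supported in `[a, b]` with vanishing integral is the derivative of a smooth
function supported in `[a, b]`. -/
theorem exists_contDiff_deriv_eq {η : ℝ → ℝ} (hη : ContDiff ℝ ((⊤ : ℕ∞) : WithTop ℕ∞) η) {a b : ℝ}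
    (hsupp : tsupport η ⊆ Icc a b) (hint : ∫ x in a..b, η x = 0) :
    ∃ Φ : ℝ → ℝ, ContDiff ℝ ((⊤ : ℕ∞) : WithTop ℕ∞) Φ ∧ tsupport Φ ⊆ Icc a b ∧
      deriv Φ = η := by
  have h0 : ∀ x, x ∉ Icc a b → η x = 0 := fun x hx =>
    image_eq_zero_of_notMem_tsupport fun h => hx (hsupp h)
  have hder : ∀ t, HasDerivAt (fun t => ∫ x in a..t, η x) (η t) t := fun t =>
    intervalIntegral.integral_hasDerivAt_right (hη.continuous.intervalIntegrable _ _)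
      hη.continuous.stronglyMeasurable.stronglyMeasurableAtFilter hη.continuous.continuousAt
  have hderiv : deriv (fun t => ∫ x in a..t, η x) = η := funext fun t => (hder t).deriv
  refine ⟨fun t => ∫ x in a..t, η x, ?_, ?_, hderiv⟩
  · rw [contDiff_infty_iff_deriv, hderiv]
    exact ⟨fun t => (hder t).differentiableAt, hη⟩
  · refine closure_minimal (fun t ht => ?_) isClosed_Icc
    by_contra hmem
    apply ht
    rcases lt_or_ge t a with h | h
    · show ∫ x in a..t, η x = 0
      rw [intervalIntegral.integral_symm, neg_eq_zero]
      refine (intervalIntegral.integral_congr_ae ?_).trans intervalIntegral.integral_zero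
      have : ∀ᵐ x : ℝ, x ≠ a := by simp [ae_iff]
      filter_upwards [this] with x hx hx'
      rw [uIoc_of_le h.le] at hx'
      exact h0 x fun h' => hx (le_antisymm hx'.2 h'.1)
    · have hbt : b < t := by
        by_contra! hh
        exact hmem ⟨h, hh⟩
      show ∫ x in a..t, η x = 0
      rw [← intervalIntegral.integral_add_adjacent_intervals
        (hη.continuous.intervalIntegrable a b) (hη.continuous.intervalIntegrable b t), hint,
        zero_add]
      refine (intervalIntegral.integral_congr_ae ?_).trans intervalIntegral.integral_zero
      refine Eventually.of_forall fun x hx => h0 x fun h' => ?_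
      rw [uIoc_of_le hbt.le] at hx
      exact absurd h'.2 (not_le.2 hx.1)

theorem IsCompact.subset_Icc_of_subset_Ioo {K : Set ℝ} (hK : IsCompact K) {T : ℝ} (hT : 0 < T)
    (h : K ⊆ Ioo 0 T) : ∃ a b, 0 < a ∧ a ≤ b ∧ b < T ∧ K ⊆ Icc a b := by
  rcases K.eq_empty_or_nonempty with rfl | hne
  · exact ⟨T / 2, T / 2, by positivity, le_rfl, by linarith, by simp⟩
  · obtain ⟨a, ha⟩ := hK.exists_isLeast hne
    obtain ⟨b, hb⟩ := hK.exists_isGreatest hne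
    exact ⟨a, b, (h ha.1).1, ha.2 hb.1, (h hb.1).2, fun x hx => ⟨ha.2 hx, hb.2 hx⟩⟩

/-- The lemma of du Bois-Reymond: a continuous function with vanishing weak derivative is
constant. -/
theorem HasWeakDerivOn.eq_of_continuousOn [CompleteSpace E] {T : ℝ} {f : ℝ → E}
    (hf : ContinuousOn f (Icc 0 T)) (h : HasWeakDerivOn T f 0) {t : ℝ} (ht : t ∈ Icc 0 T) :
    f t = f 0 := by
  rcases (ht.1.trans ht.2).eq_or_lt with rfl | hT
  · rw [le_antisymm ht.2 ht.1]
  have hfi : IntegrableOn f (Ioo 0 T) := hf.integrableOn_Icc.mono_set Ioo_subset_Icc_self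
  obtain ⟨φ, hφs, hφc, hφ, hφ01, hφ1⟩ := exists_contDiff_tsupport_subset (E := ℝ) (n := ⊤)
    (Ioo_mem_nhds (half_pos hT) (half_lt_self hT))
  have hIφ : 0 < ∫ x, φ x := by
    refine (integral_pos_iff_support_of_nonneg (fun x => (hφ01 ⟨x, rfl⟩).1)
      (hφ.continuous.integrable_of_hasCompactSupport hφc)).2 ?_
    exact (hφ.continuous.isOpen_support).measure_pos volume ⟨T / 2, by simp [hφ1]⟩
  have hset : ∀ (ψ : ℝ → ℝ) (f : ℝ → E), tsupport ψ ⊆ Ioo 0 T →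
      ∫ x in Ioo 0 T, ψ x • f x = ∫ x, ψ x • f x := fun ψ f hψ =>
    setIntegral_eq_integral_of_forall_compl_eq_zero fun x hx => by
      rw [image_eq_zero_of_notMem_tsupport fun h => hx (hψ h), zero_smul]
  have hprod : ∀ ψ : ℝ → ℝ, Continuous ψ → IntegrableOn (fun x => ψ x • f x) (Ioo 0 T) :=
    fun ψ hψ => (hψ.continuousOn.smul hf).integrableOn_Icc.mono_set Ioo_subset_Icc_self
  -- The only possible constant value of `f` is its mean weighted by the bump `φ`.
  set m : E := (∫ x, φ x)⁻¹ • ∫ x in Ioo 0 T, φ x • f x with hm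
  have key : ∀ᵐ x, x ∈ Ioo 0 T → f x - m = 0 := by
    refine isOpen_Ioo.ae_eq_zero_of_integral_contDiff_smul_eq_zero
      (hfi.sub (integrableOn_const (by simp))).locallyIntegrableOn fun ψ hψ hψc hψs => ?_
    obtain ⟨a, b, ha, hab, hb, hK⟩ := (hψc.union hφc).subset_Icc_of_subset_Ioo hT
      (union_subset hψs hφs)
    -- This choice makes `ψ - c * φ` have zero integral, hence be the derivative of an admissible
    -- test function.
    set c : ℝ := (∫ x, ψ x) / ∫ x, φ x with hc
    have hout : ∀ x, x ∉ Icc a b → ψ x = 0 ∧ φ x = 0 := fun x hx =>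
      ⟨image_eq_zero_of_notMem_tsupport fun h => hx (hK (Or.inl h)),
        image_eq_zero_of_notMem_tsupport fun h => hx (hK (Or.inr h))⟩
    obtain ⟨Φ, hΦ, hΦs, hΦd⟩ := exists_contDiff_deriv_eq (η := fun x => ψ x - c * φ x)
      (hψ.sub (contDiff_const.mul hφ))
      (closure_minimal (fun x hx => by
        by_contra hx'
        exact hx (by simp [hout x hx'])) isClosed_Icc) (by
        rw [intervalIntegral.integral_of_le hab, ← integral_Icc_eq_integral_Ioc,
          setIntegral_eq_integral_of_forall_compl_eq_zero (fun x hx => by simp [hout x hx]),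
          integral_sub (hψ.continuous.integrable_of_hasCompactSupport hψc)
            ((hφ.continuous.integrable_of_hasCompactSupport hφc).const_mul c),
          integral_const_mul, hc, div_mul_cancel₀ _ hIφ.ne', sub_self])
    have hΦ0 := h Φ hΦ (isCompact_Icc.of_isClosed_subset (isClosed_tsupport _) hΦs)
      (hΦs.trans fun x hx => ⟨ha.trans_le hx.1, hx.2.trans_lt hb⟩)
    rw [hΦd] at hΦ0
    simp only [Pi.zero_apply, smul_zero, integral_zero, neg_zero, sub_smul, mul_smul] at hΦ0
    rw [integral_sub (hprod ψ hψ.continuous) (by exact (hprod φ hφ.continuous).smul c),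
      integral_smul] at hΦ0
    rw [← hset ψ _ hψs]
    simp only [smul_sub]
    rw [integral_sub (hprod ψ hψ.continuous)
      (((hψ.continuous.integrable_of_hasCompactSupport hψc).smul_const m).integrableOn),
      hset ψ (fun _ => m) hψs, integral_smul_const, hm, smul_smul, ← div_eq_mul_inv]
    exact hΦ0
  have hconst : EqOn f (fun _ => m) (Icc 0 T) := by
    refine Measure.eqOn_Icc_of_ae_eq volume hT.ne ?_ hf continuousOn_const
    rw [← Measure.restrict_congr_set Ioo_ae_eq_Icc]
    refine (ae_restrict_iff' measurableSet_Ioo).2 ?_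
    filter_upwards [key] with x hx hx' using sub_eq_zero.1 (hx hx')
  rw [hconst ht, hconst ⟨le_rfl, hT.le⟩]

/-- A continuous function with integrable weak derivative is a primitive of it. -/
theorem HasWeakDerivOn.eq_primitive [CompleteSpace E] {T : ℝ} {f g : ℝ → E}
    (hf : ContinuousOn f (Icc 0 T)) (hg : IntegrableOn g (Ioo 0 T)) (h : HasWeakDerivOn T f g)
    {t : ℝ} (ht : t ∈ Icc 0 T) : f t = f 0 + ∫ s in (0 : ℝ)..t, g s := by
  have hprim := continuousOn_primitive_Icc hg
  have h1 : HasWeakDerivOn T (fun t => f t - ∫ s in (0 : ℝ)..t, g s) 0 := by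
    intro φ hφ hφc hφs
    have hφ1 : ContDiff ℝ 1 φ := hφ.of_le (by exact_mod_cast le_top)
    have h2 := hasWeakDerivOn_of_eq_primitive (c := 0) hg (fun t _ => (zero_add _).symm)
      φ hφ hφc hφs
    have hi : ∀ f : ℝ → E, ContinuousOn f (Icc 0 T) →
        IntegrableOn (fun t => deriv φ t • f t) (Ioo 0 T) := fun f hf =>
      (((hφ1.continuous_deriv le_rfl).continuousOn).smul hf).integrableOn_Icc.mono_set
        Ioo_subset_Icc_self
    simp only [smul_sub]
    rw [integral_sub (hi _ hf) (hi _ hprim), h φ hφ hφc hφs, h2]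
    simp
  have := h1.eq_of_continuousOn (hf.sub hprim) ht
  simpa [sub_eq_iff_eq_add] using this

end WeakDerivative

/-! ### Square-integrable functions and Cauchy-Schwarz. -/

section SquareIntegrable

variable {α : Type*} [MeasurableSpace α] {μ : Measure α}
  {E F : Type*} [NormedAddCommGroup E] [NormedAddCommGroup F]

theorem MeasureTheory.MemLp.integrable_norm_sq {f : α → E} (hf : MemLp f 2 μ) :
    Integrable (fun x => ‖f x‖ ^ 2) μ :=
  (memLp_two_iff_integrable_sq_norm hf.1).1 hf

theorem MeasureTheory.MemLp.norm_toLp_sq {f : α → E} (hf : MemLp f 2 μ) :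
    ‖hf.toLp f‖ ^ 2 = ∫ x, ‖f x‖ ^ 2 ∂μ := by
  have h0 : 0 ≤ ∫ x, ‖f x‖ ^ 2 ∂μ := integral_nonneg fun x => by positivity
  rw [Lp.norm_toLp, hf.eLpNorm_eq_integral_rpow_norm two_ne_zero ENNReal.ofNat_ne_top]
  simp only [ENNReal.toReal_ofNat, Real.rpow_ofNat]
  rw [ENNReal.toReal_ofReal (by positivity), ← Real.rpow_mul_natCast h0]
  norm_num

theorem MeasureTheory.MemLp.integrable_norm_mul_norm {f : α → E} {g : α → F} (hf : MemLp f 2 μ)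
    (hg : MemLp g 2 μ) : Integrable (fun x => ‖f x‖ * ‖g x‖) μ :=
  hf.norm.integrable_mul hg.norm

/-- The Cauchy-Schwarz inequality. -/
theorem MeasureTheory.MemLp.integral_norm_mul_norm_le {f : α → E} {g : α → F} (hf : MemLp f 2 μ)
    (hg : MemLp g 2 μ) :
    ∫ x, ‖f x‖ * ‖g x‖ ∂μ ≤ √(∫ x, ‖f x‖ ^ 2 ∂μ) * √(∫ x, ‖g x‖ ^ 2 ∂μ) := by
  have := integral_mul_norm_le_Lp_mul_Lq (μ := μ) (f := fun x => ‖f x‖) (g := fun x => ‖g x‖)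
    Real.HolderConjugate.two_two (by simpa using hf.norm) (by simpa using hg.norm)
  simpa [Real.sqrt_eq_rpow] using this

theorem MeasureTheory.MemLp.indicator_of_restrict {f : α → E} {p : ℝ≥0∞} {s : Set α}
    (hf : MemLp f p (μ.restrict s)) (hs : MeasurableSet s) : MemLp (s.indicator f) p μ :=
  (memLp_indicator_iff_restrict hs).2 hf

theorem MeasureTheory.IntegrableOn.intervalIntegrable_of_mem_Icc {f : ℝ → E} {T a b : ℝ}
    (hf : IntegrableOn f (Ioo 0 T)) (ha : a ∈ Icc 0 T) (hb : b ∈ Icc 0 T) :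
    IntervalIntegrable f volume a b :=
  (IntegrableOn.mono_set (by rwa [integrableOn_Icc_iff_integrableOn_Ioo])
    (uIcc_subset_Icc ha hb)).intervalIntegrable

end SquareIntegrable

/-! ### Continuity of translations in `L²`. -/

section Translation

variable {E : Type*} [NormedAddCommGroup E]

/-- Translations are continuous in `L²(ℝ; E)`. -/
theorem MeasureTheory.MemLp.tendsto_sqrt_integral_translate_sub {f : ℝ → E}
    (hf : MemLp f 2 volume) :
    Tendsto (fun h => √(∫ s, ‖f (s + h) - f s‖ ^ 2)) (𝓝 0) (𝓝 0) := by
  let g : C(ℝ, C(ℝ, ℝ)) := ContinuousMap.curry ⟨fun a : ℝ × ℝ => a.2 + a.1, by fun_prop⟩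
  have hgm : ∀ h, MeasurePreserving (g h) volume volume := fun h =>
    measurePreserving_add_right volume h
  have h1 : Continuous fun h => Lp.compMeasurePreserving (g h) (hgm h) (hf.toLp f) :=
    continuous_const.compMeasurePreservingLp g.continuous hgm ENNReal.ofNat_ne_top
  have h2 : ∀ h, ‖Lp.compMeasurePreserving (g h) (hgm h) (hf.toLp f) - hf.toLp f‖ =
      √(∫ s, ‖f (s + h) - f s‖ ^ 2) := by
    intro h
    have h3 : MemLp (f ∘ g h) 2 volume := hf.comp_measurePreserving (hgm h)
    rw [Lp.toLp_compMeasurePreserving hf (hgm h), ← MemLp.toLp_sub,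
      ← Real.sqrt_sq (norm_nonneg _), (h3.sub hf).norm_toLp_sq]
    rfl
  have h4 : Lp.compMeasurePreserving (g 0) (hgm 0) (hf.toLp f) = hf.toLp f := by
    rw [Lp.toLp_compMeasurePreserving hf (hgm 0)]
    congr 1
    funext s
    simp [g]
  have h5 := (h1.tendsto 0).sub_const (hf.toLp f) |>.norm
  rw [h4, sub_self, norm_zero] at h5
  exact h5.congr h2

theorem MeasureTheory.MemLp.translate {f : ℝ → E} (hf : MemLp f 2 volume) (h : ℝ) :
    MemLp (fun s => f (s + h)) 2 volume :=
  hf.comp_measurePreserving (measurePreserving_add_right volume h)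

end Translation

/-! ### The energy identity via Steklov quotients. -/

section Energy

variable {V H : Type*} [NormedAddCommGroup V] [NormedSpace ℝ V]

theorem MeasureTheory.MemLp.integrable_apply {α : Type*} [MeasurableSpace α] {μ : Measure α}
    {g : α → V →L[ℝ] ℝ} {w : α → V}
    (hg : MemLp g 2 μ) (hw : MemLp w 2 μ) : Integrable (fun x => g x (w x)) μ :=
  (hg.integrable_norm_mul_norm hw).mono'
    ((ContinuousLinearMap.id ℝ (V →L[ℝ] ℝ)).aestronglyMeasurable_comp₂ hg.1 hw.1)
    (Eventually.of_forall fun x => (g x).le_opNorm (w x))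

/-- The shear `(r, s) ↦ (r, r + s)` preserves the product measure, so both square norms are
integrable over the finite range of `r` and dominate the pairing. This licenses the exchange of
integrals in the energy identity. -/
theorem MeasureTheory.MemLp.integrable_prod_translate_apply {G : ℝ → V →L[ℝ] ℝ} {W : ℝ → V}
    (hG : MemLp G 2 volume) (hW : MemLp W 2 volume) (ν : Measure ℝ) [IsFiniteMeasure ν]
    (S : Set ℝ) :
    Integrable (Function.uncurry fun r s : ℝ => G (r + s) (W s)) (ν.prod (volume.restrict S)) := by
  have hmp := measurePreserving_prod_add ν (volume : Measure ℝ)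
  have h1 : AEStronglyMeasurable (fun z : ℝ × ℝ => G (z.1 + z.2)) (ν.prod volume) :=
    (hG.1.comp_snd (μ := ν)).comp_measurePreserving hmp
  have h2 : AEStronglyMeasurable (fun z : ℝ × ℝ => W z.2) (ν.prod volume) := hW.1.comp_snd
  have h3 : Integrable (fun z : ℝ × ℝ => ‖G (z.1 + z.2)‖ ^ 2) (ν.prod volume) :=
    hmp.integrable_comp_of_integrable (hG.integrable_norm_sq.comp_snd ν)
  have h4 : Integrable (fun z : ℝ × ℝ => ‖W z.2‖ ^ 2) (ν.prod volume) :=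
    hW.integrable_norm_sq.comp_snd ν
  refine Integrable.mono_measure (ν := ν.prod volume) ?_
    (Measure.prod_mono le_rfl Measure.restrict_le_self)
  refine (h3.add h4).mono'
    ((ContinuousLinearMap.id ℝ (V →L[ℝ] ℝ)).aestronglyMeasurable_comp₂ h1 h2)
    (Eventually.of_forall fun z => ?_)
  refine ((G (z.1 + z.2)).le_opNorm (W z.2)).trans ?_
  simp only [Pi.add_apply]
  nlinarith [sq_nonneg (‖G (z.1 + z.2)‖ - ‖W z.2‖), sq_nonneg ‖G (z.1 + z.2)‖,
    sq_nonneg ‖W z.2‖]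

/-- Move the translation off `G` first and then off `W`, using Cauchy-Schwarz for each difference.
Since the integrals on the right run over the whole line, the bound does not depend on `S`, which
later varies with `h`. -/
theorem MeasureTheory.MemLp.norm_setIntegral_translate_apply_sub_le {G : ℝ → V →L[ℝ] ℝ} {W : ℝ → V}
    (hG : MemLp G 2 volume) (hW : MemLp W 2 volume) (r h : ℝ) (S : Set ℝ) :
    ‖(∫ s in S, G (r + s) (W (s + h) + W s)) - ∫ s in S, G s (W s + W s)‖ ≤
      √(∫ s, ‖G (s + r) - G s‖ ^ 2) * (2 * √(∫ s, ‖W s‖ ^ 2)) +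
        √(∫ s, ‖G s‖ ^ 2) * √(∫ s, ‖W (s + h) - W s‖ ^ 2) := by
  have hWh := hW.translate h
  have hGr := hG.translate r
  have hGd : MemLp (fun s => G (s + r) - G s) 2 volume := hGr.sub hG
  have hWd : MemLp (fun s => W (s + h) - W s) 2 volume := hWh.sub hW
  have i1 := (hGd.integrable_norm_mul_norm hWh).restrict (s := S)
  have i2 := (hGd.integrable_norm_mul_norm hW).restrict (s := S)
  have i3 := (hG.integrable_norm_mul_norm hWd).restrict (s := S)
  have i12 : Integrable (fun s => ‖G (s + r) - G s‖ * ‖W (s + h)‖ + ‖G (s + r) - G s‖ * ‖W s‖)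
    (volume.restrict S) := i1.add i2
  have hmono : ∀ {f : ℝ → ℝ}, Integrable f → (∀ x, 0 ≤ f x) → ∫ s in S, f s ≤ ∫ s, f s :=
    fun hf h0 => setIntegral_le_integral hf (Eventually.of_forall h0)
  have e1 : ∫ s, ‖W (s + h)‖ ^ 2 = ∫ s, ‖W s‖ ^ 2 :=
    integral_add_right_eq_self (fun s => ‖W s‖ ^ 2) h
  have b1 := (hmono (hGd.integrable_norm_mul_norm hWh) fun x => by positivity).trans
    (hGd.integral_norm_mul_norm_le hWh)
  have b2 := (hmono (hGd.integrable_norm_mul_norm hW) fun x => by positivity).trans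
    (hGd.integral_norm_mul_norm_le hW)
  have b3 := (hmono (hG.integrable_norm_mul_norm hWd) fun x => by positivity).trans
    (hG.integral_norm_mul_norm_le hWd)
  rw [e1] at b1
  have hGr' : MemLp (fun s => G (r + s)) 2 volume := by simpa only [add_comm] using hGr
  have j1 : Integrable (fun s => G (r + s) (W (s + h) + W s)) (volume.restrict S) :=
    (hGr'.integrable_apply (hWh.add hW)).restrict
  have j2 : Integrable (fun s => G s (W s + W s)) (volume.restrict S) :=
    (hG.integrable_apply (hW.add hW)).restrict
  rw [← integral_sub j1 j2]
  calc _ ≤ ∫ s in S, (‖G (s + r) - G s‖ * ‖W (s + h)‖ + ‖G (s + r) - G s‖ * ‖W s‖ +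
        ‖G s‖ * ‖W (s + h) - W s‖) := by
        refine norm_integral_le_of_norm_le (i12.add i3) (Eventually.of_forall fun s => ?_)
        have : G (r + s) (W (s + h) + W s) - G s (W s + W s) =
            (G (s + r) - G s) (W (s + h)) + (G (s + r) - G s) (W s) +
              G s (W (s + h) - W s) := by
          rw [add_comm r s]
          simp only [map_add, map_sub, sub_apply]
          ring
        rw [this]
        exact (norm_add₃_le).trans (add_le_add_three (ContinuousLinearMap.le_opNorm _ _)
          (ContinuousLinearMap.le_opNorm _ _) (ContinuousLinearMap.le_opNorm _ _))
    _ = _ := by rw [integral_add i12 i3, integral_add i1 i2]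
    _ ≤ _ := by
        linarith

/-- For `0 < r ≤ h` with `h` small the inner integral is uniformly close to its limit, because
translations are continuous in `L²`; the average over `r` inherits this. -/
theorem MeasureTheory.MemLp.tendsto_average_translate_apply {G : ℝ → V →L[ℝ] ℝ} {W : ℝ → V}
    (hG : MemLp G 2 volume) (hW : MemLp W 2 volume) {T : ℝ} (hT : 0 < T) :
    Tendsto (fun h : ℝ => h⁻¹ * ∫ r in (0 : ℝ)..h, ∫ s in Ioo 0 (T - h),
      G (r + s) (W (s + h) + W s)) (𝓝[>] 0) (𝓝 (∫ s in Ioo 0 T, G s (W s + W s))) := by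
  have hq : Integrable (fun s => G s (W s + W s)) := hG.integrable_apply (hW.add hW)
  have hD : Tendsto (fun h => ∫ s in Ioo 0 (T - h), G s (W s + W s)) (𝓝 0)
      (𝓝 (∫ s in Ioo 0 T, G s (W s + W s))) := by
    have h1 : Continuous fun h => ∫ s in (0 : ℝ)..(T - h), G s (W s + W s) :=
      (intervalIntegral.continuous_primitive (fun a b => hq.intervalIntegrable) 0).comp
        (continuous_const.sub continuous_id)
    have h2 := h1.tendsto 0
    have h3 : ∀ h ≤ T, ∫ s in (0 : ℝ)..(T - h), G s (W s + W s) =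
        ∫ s in Ioo 0 (T - h), G s (W s + W s) := fun h hh => by
      rw [intervalIntegral.integral_of_le (sub_nonneg.2 hh), integral_Ioc_eq_integral_Ioo]
    rw [h3 0 hT.le, sub_zero] at h2
    exact h2.congr' (eventually_of_mem (Iic_mem_nhds hT) fun h hh => h3 h hh)
  have hA : Tendsto (fun r => √(∫ s, ‖G (s + r) - G s‖ ^ 2) * (2 * √(∫ s, ‖W s‖ ^ 2)))
      (𝓝 0) (𝓝 0) := by
    simpa using hG.tendsto_sqrt_integral_translate_sub.mul_const (2 * √(∫ s, ‖W s‖ ^ 2))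
  have hB : Tendsto (fun h => √(∫ s, ‖G s‖ ^ 2) * √(∫ s, ‖W (s + h) - W s‖ ^ 2))
      (𝓝 0) (𝓝 0) := by
    simpa using hW.tendsto_sqrt_integral_translate_sub.const_mul (√(∫ s, ‖G s‖ ^ 2))
  rw [Metric.tendsto_nhds]
  intro ε hε
  -- There are three errors: translating `G`, translating `W`, and shrinking the domain to `(0, T -
  -- h)`. Quarters leave room for strictness.
  have hε4 : 0 < ε / 4 := by positivity
  obtain ⟨δ, hδ, hδA⟩ := Metric.eventually_nhds_iff.1 (Metric.tendsto_nhds.1 hA _ hε4)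
  have hev : ∀ᶠ h in 𝓝[>] (0 : ℝ), h < δ ∧ 0 < h :=
    inter_mem (mem_nhdsWithin_of_mem_nhds (Iio_mem_nhds hδ)) self_mem_nhdsWithin
  filter_upwards [hev, nhdsWithin_le_nhds (Metric.tendsto_nhds.1 hD _ hε4),
    nhdsWithin_le_nhds (Metric.tendsto_nhds.1 hB _ hε4)] with h hh hDh hBh
  obtain ⟨hhδ, hh0⟩ := hh
  set I := ∫ s in Ioo 0 T, G s (W s + W s)
  have hint : IntervalIntegrable (fun r => ∫ s in Ioo 0 (T - h), G (r + s) (W (s + h) + W s))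
      volume 0 h := by
    rw [intervalIntegrable_iff_integrableOn_Ioc_of_le hh0.le]
    exact (hG.integrable_prod_translate_apply ((hW.translate h).add hW)
      (volume.restrict (Ioc 0 h)) (Ioo 0 (T - h))).integral_prod_left
  have hbound : ∀ r ∈ uIoc 0 h,
      ‖(∫ s in Ioo 0 (T - h), G (r + s) (W (s + h) + W s)) - I‖ ≤ 3 * (ε / 4) := by
    intro r hr
    rw [uIoc_of_le hh0.le] at hr
    have hAr := hδA (y := r) (by
      rw [dist_zero_right, Real.norm_of_nonneg hr.1.le]; exact hr.2.trans_lt hhδ)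
    rw [dist_zero_right] at hAr hBh
    have h1 := hG.norm_setIntegral_translate_apply_sub_le hW r h (Ioo 0 (T - h))
    have h2 := norm_sub_le_norm_sub_add_norm_sub
      (∫ s in Ioo 0 (T - h), G (r + s) (W (s + h) + W s))
      (∫ s in Ioo 0 (T - h), G s (W s + W s)) I
    rw [← dist_eq_norm (∫ s in Ioo 0 (T - h), G s (W s + W s)) I] at h2
    have h3 := (le_abs_self _).trans hAr.le
    have h4 := (le_abs_self _).trans hBh.le
    linarith
  have h5 := intervalIntegral.norm_integral_le_of_norm_le_const hbound
  rw [intervalIntegral.integral_sub hint intervalIntegrable_const,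
    intervalIntegral.integral_const, sub_zero, abs_of_pos hh0, smul_eq_mul] at h5
  rw [dist_eq_norm]
  have h6 : h⁻¹ * (∫ r in (0 : ℝ)..h, ∫ s in Ioo 0 (T - h), G (r + s) (W (s + h) + W s)) - I =
      h⁻¹ * ((∫ r in (0 : ℝ)..h, ∫ s in Ioo 0 (T - h), G (r + s) (W (s + h) + W s)) - h * I) := by
    field_simp
  rw [h6, norm_mul, norm_inv, Real.norm_of_nonneg hh0.le]
  calc _ ≤ h⁻¹ * (3 * (ε / 4) * h) := by gcongr
    _ = 3 * (ε / 4) := by field_simp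
    _ < ε := by linarith

/-- Steklov quotients of a function that is continuous on `[0, T]`. -/
theorem ContinuousOn.tendsto_average_translate_sub {N : ℝ → ℝ} {T : ℝ} (hT : 0 < T)
    (hN : ContinuousOn N (Icc 0 T)) :
    Tendsto (fun h : ℝ => h⁻¹ * ∫ s in Ioo 0 (T - h), (N (s + h) - N s)) (𝓝[>] 0)
      (𝓝 (N T - N 0)) := by
  have hi : ∀ {a b}, a ∈ Icc 0 T → b ∈ Icc 0 T → IntervalIntegrable N volume a b :=
    fun {a b} ha hb => (hN.mono (uIcc_subset_Icc ha hb)).intervalIntegrable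
  have h0 : (0 : ℝ) ∈ Icc 0 T := ⟨le_rfl, hT.le⟩
  have hT' : T ∈ Icc 0 T := ⟨hT.le, le_rfl⟩
  have hmeas : ∀ x, StronglyMeasurableAtFilter N (𝓝[Icc 0 T] x) volume := fun x =>
    ⟨Icc 0 T, self_mem_nhdsWithin, hN.aestronglyMeasurable measurableSet_Icc⟩
  have d0 : HasDerivWithinAt (fun t => ∫ s in (0 : ℝ)..t, N s) (N 0) (Icc 0 T) 0 := by
    have : Fact ((0 : ℝ) ∈ Icc 0 T) := ⟨h0⟩
    exact intervalIntegral.integral_hasDerivWithinAt_right (hi h0 h0) (hmeas 0) (hN 0 h0)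
  have dT : HasDerivWithinAt (fun t => ∫ s in (0 : ℝ)..t, N s) (N T) (Icc 0 T) T := by
    have : Fact (T ∈ Icc 0 T) := ⟨hT'⟩
    exact intervalIntegral.integral_hasDerivWithinAt_right (hi h0 hT') (hmeas T) (hN T hT')
  have hev : ∀ᶠ h in 𝓝[>] (0 : ℝ), 0 < h ∧ h < T := Ioo_mem_nhdsGT hT
  have l0 : Tendsto (fun h : ℝ => h⁻¹ * ∫ s in (0 : ℝ)..h, N s) (𝓝[>] 0) (𝓝 (N 0)) := by
    have h1 := hasDerivWithinAt_iff_tendsto_slope.1 d0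
    have h2 : Tendsto (fun h : ℝ => h) (𝓝[>] 0) (𝓝[Icc 0 T \ {0}] 0) := by
      refine tendsto_nhdsWithin_iff.2 ⟨nhdsWithin_le_nhds, ?_⟩
      filter_upwards [hev] with h hh using ⟨⟨hh.1.le, hh.2.le⟩, hh.1.ne'⟩
    refine (h1.comp h2).congr fun h => ?_
    simp [slope_def_field, div_eq_inv_mul]
  have lT : Tendsto (fun h : ℝ => h⁻¹ * ∫ s in (T - h)..T, N s) (𝓝[>] 0) (𝓝 (N T)) := by
    have h1 := hasDerivWithinAt_iff_tendsto_slope.1 dT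
    have h2 : Tendsto (fun h : ℝ => T - h) (𝓝[>] 0) (𝓝[Icc 0 T \ {T}] T) := by
      refine tendsto_nhdsWithin_iff.2 ⟨?_, ?_⟩
      · have : Tendsto (fun h : ℝ => T - h) (𝓝 0) (𝓝 (T - 0)) := by
          exact (continuous_const.sub continuous_id).tendsto 0
        rw [sub_zero] at this
        exact this.mono_left nhdsWithin_le_nhds
      · filter_upwards [hev] with h hh using
          ⟨⟨by linarith [hh.2], by linarith [hh.1]⟩, by simp [hh.1.ne']⟩
    refine (h1.comp h2).congr' ?_
    filter_upwards [hev] with h hh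
    have hm : T - h ∈ Icc 0 T := ⟨by linarith [hh.2], by linarith [hh.1]⟩
    simp only [Function.comp, slope_def_field]
    rw [← intervalIntegral.integral_add_adjacent_intervals (hi h0 hm) (hi hm hT')]
    rw [sub_sub_cancel_left, div_neg, ← neg_div, div_eq_inv_mul]
    ring
  -- The integral telescopes to the one of `N` over `[T - h, T]` minus the one over `[0, h]`.
  refine (lT.sub l0).congr' ?_
  filter_upwards [hev] with h hh
  have hm : T - h ∈ Icc 0 T := ⟨by linarith [hh.2], by linarith [hh.1]⟩
  have hm' : h ∈ Icc 0 T := ⟨hh.1.le, hh.2.le⟩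
  have i2 : IntervalIntegrable (fun s => N (s + h)) volume 0 (T - h) := by
    refine ContinuousOn.intervalIntegrable ?_
    refine hN.comp (by fun_prop) fun s hs => ?_
    rw [uIcc_of_le hm.1] at hs
    exact ⟨by linarith [hs.1, hh.1], by linarith [hs.2]⟩
  rw [← integral_Ioc_eq_integral_Ioo, ← intervalIntegral.integral_of_le hm.1,
    intervalIntegral.integral_sub i2 (hi h0 hm), intervalIntegral.integral_comp_add_right,
    zero_add, sub_add_cancel, ← intervalIntegral.integral_add_adjacent_intervals
      (hi hm' hm) (hi hm hT'), ← intervalIntegral.integral_add_adjacent_intervals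
      (hi h0 hm') (hi hm' hm)]
  ring

/-- The energy identity in a Gelfand triple: if `y` is continuous with values in `H`, square
integrable with values in `V`, and `y' = g` is square integrable with values in `V*`, then
`‖y(T)‖² = ‖y(0)‖² + 2 ∫ ⟨g, y⟩`. -/
theorem norm_sq_eq_add_two_mul_setIntegral {H : Type*} [NormedAddCommGroup H]
    [InnerProductSpace ℝ H] (ι : V →L[ℝ] H) {T : ℝ} (hT : 0 ≤ T) {y : ℝ → H} {w : ℝ → V}
    {g : ℝ → V →L[ℝ] ℝ} (hy : ContinuousOn y (Icc 0 T))
    (hw : MemLp w 2 (volume.restrict (Ioo 0 T))) (hg : MemLp g 2 (volume.restrict (Ioo 0 T)))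
    (hae : ∀ᵐ t ∂volume.restrict (Ioo 0 T), ι (w t) = y t)
    (hprim : ∀ t ∈ Icc 0 T,
      (innerSL ℝ (y t)).comp ι = (innerSL ℝ (y 0)).comp ι + ∫ s in (0 : ℝ)..t, g s) :
    ‖y T‖ ^ 2 = ‖y 0‖ ^ 2 + 2 * ∫ s in Ioo 0 T, g s (w s) := by
  rcases hT.eq_or_lt with rfl | hT
  · simp
  -- Extension by zero makes translations on the whole line available.
  set G := (Ioo 0 T).indicator g with hG_def
  set W := (Ioo 0 T).indicator w with hW_def
  have hG : MemLp G 2 volume := hg.indicator_of_restrict measurableSet_Ioo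
  have hW : MemLp W 2 volume := hw.indicator_of_restrict measurableSet_Ioo
  have hgi : IntegrableOn g (Ioo 0 T) := hg.integrable one_le_two
  have hN : ContinuousOn (fun t => ‖y t‖ ^ 2) (Icc 0 T) := hy.norm.pow 2
  have l1 := hN.tendsto_average_translate_sub hT
  have l2 := hG.tendsto_average_translate_apply hW hT
  have hae' : ∀ᵐ t, t ∈ Ioo 0 T → ι (w t) = y t := (ae_restrict_iff' measurableSet_Ioo).1 hae
  have hev : ∀ᶠ h in 𝓝[>] (0 : ℝ), 0 < h ∧ h < T := Ioo_mem_nhdsGT hT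
  -- The increment of `y` over `[s, s + h]` is the integral of `g`. Pairing it with `w (s + h) + w
  -- s`, rather than with one of the two, gives exactly `‖y (s + h)‖ ^ 2 - ‖y s‖ ^ 2`, so both
  -- limits concern the same quotient.
  have hlim : ‖y T‖ ^ 2 - ‖y 0‖ ^ 2 = ∫ s in Ioo 0 T, G s (W s + W s) := by
    refine tendsto_nhds_unique l1 (l2.congr' ?_)
    filter_upwards [hev] with h hh
    have hWW : MemLp (fun s => W (s + h) + W s) 2 volume := (hW.translate h).add hW
    have hprod := hG.integrable_prod_translate_apply hWW (volume.restrict (Ioc 0 h))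
      (Ioo 0 (T - h))
    rw [← uIoc_of_le hh.1.le] at hprod
    rw [intervalIntegral_integral_swap hprod]
    congr 1
    refine integral_congr_ae ?_
    refine (ae_restrict_iff' measurableSet_Ioo).2 ?_
    have hae'' := (measurePreserving_add_right volume h).quasiMeasurePreserving.ae hae'
    filter_upwards [hae', hae''] with s h1 h2 hs
    have hs0 : s ∈ Ioo 0 T := ⟨hs.1, by linarith [hs.2, hh.1]⟩
    have hsh : s + h ∈ Ioo 0 T := ⟨by linarith [hs.1, hh.1], by linarith [hs.2]⟩
    have hs0' := Ioo_subset_Icc_self hs0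
    have hsh' := Ioo_subset_Icc_self hsh
    have h0 : (0 : ℝ) ∈ Icc 0 T := ⟨le_rfl, hT.le⟩
    have hint : ∫ r in (0 : ℝ)..h, G (r + s) = ∫ x in s..(s + h), g x := by
      rw [intervalIntegral.integral_comp_add_right, zero_add, add_comm h s]
      refine intervalIntegral.integral_congr fun x hx => ?_
      rw [uIcc_of_le (by linarith [hh.1])] at hx
      exact indicator_of_mem (s := Ioo 0 T) ⟨hs0.1.trans_le hx.1, hx.2.trans_lt hsh.2⟩ g
    have hint2 : ∫ x in s..(s + h), g x =
        (innerSL ℝ (y (s + h))).comp ι - (innerSL ℝ (y s)).comp ι := by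
      rw [hprim _ hs0', hprim _ hsh', ← intervalIntegral.integral_add_adjacent_intervals
        (hgi.intervalIntegrable_of_mem_Icc h0 hs0')
        (hgi.intervalIntegrable_of_mem_Icc hs0' hsh')]
      abel
    have hGi : IntervalIntegrable (fun r => G (r + s)) volume 0 h := by
      have := (hG.translate s).restrict (Ioc 0 h)
      exact (intervalIntegrable_iff_integrableOn_Ioc_of_le hh.1.le).2 (this.integrable one_le_two)
    rw [← ContinuousLinearMap.intervalIntegral_apply hGi, hint, hint2, hW_def,
      indicator_of_mem hs0, indicator_of_mem hsh]
    change inner ℝ (y (s + h)) (ι (w (s + h) + w s)) - inner ℝ (y s) (ι (w (s + h) + w s)) =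
      ‖y (s + h)‖ ^ 2 - ‖y s‖ ^ 2
    rw [map_add, h1 hs0, h2 hsh, inner_add_right, inner_add_right, real_inner_self_eq_norm_sq,
      real_inner_self_eq_norm_sq, real_inner_comm (y s)]
    ring
  have hlast : ∫ s in Ioo 0 T, G s (W s + W s) = 2 * ∫ s in Ioo 0 T, g s (w s) := by
    rw [← integral_const_mul]
    refine setIntegral_congr_fun measurableSet_Ioo fun s hs => ?_
    simp only [hG_def, hW_def, indicator_of_mem hs, map_add]
    ring
  linarith

end Energy

/-! ### Trajectories in integrated form. -/

theorem MeasureTheory.MemLp.mono_Ioo {E : Type*} [NormedAddCommGroup E] {f : ℝ → E} {p : ℝ≥0∞}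
    {S T : ℝ} (hf : MemLp f p (volume.restrict (Ioo 0 T))) (hS : S ≤ T) :
    MemLp f p (volume.restrict (Ioo 0 S)) :=
  hf.mono_measure (Measure.restrict_mono (Ioo_subset_Ioo_right hS) le_rfl)

theorem MeasureTheory.MemLp.smul_add_smul {α E : Type*} [MeasurableSpace α] {μ : Measure α}
    [NormedAddCommGroup E] [NormedSpace ℝ E] {f g : α → E} {p : ℝ≥0∞} (hf : MemLp f p μ)
    (hg : MemLp g p μ) (c d : ℝ) : MemLp (fun x => c • f x + d • g x) p μ :=
  (hf.const_smul c).add (hg.const_smul d)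

namespace ControlProblem

variable {V H : Type*}
    [NormedAddCommGroup V] [InnerProductSpace ℝ V] [NormedAddCommGroup H] [InnerProductSpace ℝ H]
    {ω : Type*} [MeasurableSpace ω] {ϱ : Measure ω} (P : ControlProblem V H ϱ)

/-- The time derivative `B u - A w` of a trajectory. -/
noncomputable def velocity (u : ℝ → Lp ℝ 2 ϱ) (w : ℝ → V) (t : ℝ) : V →L[ℝ] ℝ :=
  P.B (u t) - P.a (w t)

/-- The state equation in integrated form. -/
structure IsTrajectory (T : ℝ) (u : ℝ → Lp ℝ 2 ϱ) (x : H) (y : ℝ → H) (w : ℝ → V) : Prop where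
  continuousOn : ContinuousOn y (Icc 0 T)
  memLp : MemLp w 2 (volume.restrict (Ioo 0 T))
  ae_eq : ∀ᵐ t ∂volume.restrict (Ioo 0 T), P.ι (w t) = y t
  init : y 0 = x
  toDual_eq : ∀ t ∈ Icc 0 T, P.toDual (y t) = P.toDual x + ∫ s in (0 : ℝ)..t, P.velocity u w s

variable {P} {T : ℝ} {u : ℝ → Lp ℝ 2 ϱ} {x : H} {y : ℝ → H} {w : ℝ → V}

theorem memLp_velocity {μ : Measure ℝ} (hu : MemLp u 2 μ) (hw : MemLp w 2 μ) :
    MemLp (P.velocity u w) 2 μ :=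
  (P.B.comp_memLp' hu).sub (P.a.comp_memLp' hw)

theorem continuous_toDual : Continuous P.toDual :=
  (innerSL ℝ).continuous.clm_comp continuous_const

theorem toDual_add (h k : H) : P.toDual (h + k) = P.toDual h + P.toDual k := by
  simp [toDual, ContinuousLinearMap.add_comp]

theorem toDual_smul (c : ℝ) (h : H) : P.toDual (c • h) = c • P.toDual h := by
  simp [toDual, ContinuousLinearMap.smul_comp]

theorem toDual_sub (h k : H) : P.toDual (h - k) = P.toDual h - P.toDual k := by
  simp [toDual, ContinuousLinearMap.sub_comp]

theorem eq_zero_of_toDual_eq_zero (hdense : DenseRange P.ι) {h : H} (hh : P.toDual h = 0) :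
    h = 0 := by
  have h1 : Continuous fun k : H => (inner ℝ h k : ℝ) := continuous_const.inner continuous_id
  have h2 : (fun k : H => (inner ℝ h k : ℝ)) = fun _ => 0 := by
    refine hdense.equalizer h1 continuous_const ?_
    funext v
    exact DFunLike.congr_fun hh v
  exact inner_self_eq_zero.1 (congrFun h2 h)

theorem setIntegral_interval_congr_ae {E : Type*} [NormedAddCommGroup E] [NormedSpace ℝ E]
    {f g : ℝ → E} (h : ∀ᵐ t ∂volume.restrict (Ioo 0 T), f t = g t) {t : ℝ} (ht : t ∈ Icc 0 T) :
    ∫ s in (0 : ℝ)..t, f s = ∫ s in (0 : ℝ)..t, g s := by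
  rw [intervalIntegral.integral_of_le ht.1, intervalIntegral.integral_of_le ht.1,
    integral_Ioc_eq_integral_Ioo, integral_Ioc_eq_integral_Ioo]
  exact integral_congr_ae (ae_mono (Measure.restrict_mono (Ioo_subset_Ioo_right ht.2) le_rfl) h)

/-- Du Bois-Reymond in `V*` removes the test functions; the integrated form passes easily to
restrictions, concatenations and limits. -/
theorem IsState.exists_isTrajectory (h : P.IsState T u x y) :
    ∃ w, P.IsTrajectory T u x y w := by
  obtain ⟨w, y', hW, heq, h0⟩ := h
  refine ⟨w, hW.continuousOn, hW.memLp, hW.ae_eq, h0, fun t ht => ?_⟩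
  have h1 : P.toDual (y t) = P.toDual (y 0) + ∫ s in (0 : ℝ)..t, y' s :=
    hW.hasWeakDeriv.eq_primitive (continuous_toDual.comp_continuousOn hW.continuousOn)
      (hW.memLp_deriv.integrable one_le_two) ht
  rw [h1, h0]
  congr 1
  refine setIntegral_interval_congr_ae ?_ ht
  filter_upwards [heq] with s hs
  rw [velocity, ← hs, add_sub_cancel_right]

theorem IsTrajectory.isState (h : P.IsTrajectory T u x y w)
    (hu : MemLp u 2 (volume.restrict (Ioo 0 T))) : P.IsState T u x y := by
  have hv := memLp_velocity (P := P) hu h.memLp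
  refine ⟨w, P.velocity u w, ⟨h.continuousOn, h.memLp, h.ae_eq, hv, ?_⟩, ?_, h.init⟩
  · exact hasWeakDerivOn_of_eq_primitive (hv.integrable one_le_two)
      fun t ht => h.toDual_eq t (Ioo_subset_Icc_self ht)
  · exact Eventually.of_forall fun t => sub_add_cancel _ _

theorem IsTrajectory.mono (h : P.IsTrajectory T u x y w) {S : ℝ} (hS : S ≤ T) :
    P.IsTrajectory S u x y w where
  continuousOn := h.continuousOn.mono (Icc_subset_Icc_right hS)
  memLp := h.memLp.mono_Ioo hS
  ae_eq := ae_mono (Measure.restrict_mono (Ioo_subset_Ioo_right hS) le_rfl) h.ae_eq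
  init := h.init
  toDual_eq := fun t ht => h.toDual_eq t ⟨ht.1, ht.2.trans hS⟩

theorem IsAdmissible.mono (h : P.IsAdmissible T u) {S : ℝ} (hS : S ≤ T) :
    P.IsAdmissible S u :=
  ⟨h.1.mono_Ioo hS,
    ae_mono (Measure.restrict_mono (Ioo_subset_Ioo_right hS) le_rfl) h.2⟩

theorem IsTrajectory.congr (h : P.IsTrajectory T u x y w) {u' : ℝ → Lp ℝ 2 ϱ} {w' : ℝ → V}
    (hu : ∀ᵐ t ∂volume.restrict (Ioo 0 T), u t = u' t)
    (hw : ∀ᵐ t ∂volume.restrict (Ioo 0 T), w t = w' t) : P.IsTrajectory T u' x y w' where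
  continuousOn := h.continuousOn
  memLp := h.memLp.ae_eq hw
  ae_eq := by
    filter_upwards [hw, h.ae_eq] with t h1 h2
    rw [← h1, h2]
  init := h.init
  toDual_eq := fun t ht => by
    rw [h.toDual_eq t ht]
    congr 1
    refine setIntegral_interval_congr_ae ?_ ht
    filter_upwards [hu, hw] with t h1 h2
    rw [velocity, velocity, h1, h2]

section Linear

variable {u₁ u₂ : ℝ → Lp ℝ 2 ϱ} {x₁ x₂ : H} {y₁ y₂ : ℝ → H} {w₁ w₂ : ℝ → V}

theorem intervalIntegrable_velocity (hu : MemLp u 2 (volume.restrict (Ioo 0 T)))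
    (hw : MemLp w 2 (volume.restrict (Ioo 0 T))) {s t : ℝ} (hs : s ∈ Icc 0 T) (ht : t ∈ Icc 0 T) :
    IntervalIntegrable (P.velocity u w) volume s t :=
  IntegrableOn.intervalIntegrable_of_mem_Icc
    ((memLp_velocity hu hw).integrable one_le_two) hs ht

theorem IsTrajectory.smul_add_smul (h₁ : P.IsTrajectory T u₁ x₁ y₁ w₁)
    (h₂ : P.IsTrajectory T u₂ x₂ y₂ w₂) (hu₁ : MemLp u₁ 2 (volume.restrict (Ioo 0 T)))
    (hu₂ : MemLp u₂ 2 (volume.restrict (Ioo 0 T))) (c d : ℝ) :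
    P.IsTrajectory T (fun t => c • u₁ t + d • u₂ t) (c • x₁ + d • x₂)
      (fun t => c • y₁ t + d • y₂ t) (fun t => c • w₁ t + d • w₂ t) where
  continuousOn := (h₁.continuousOn.const_smul c).add (h₂.continuousOn.const_smul d)
  memLp := h₁.memLp.smul_add_smul h₂.memLp c d
  ae_eq := by
    filter_upwards [h₁.ae_eq, h₂.ae_eq] with t e₁ e₂
    rw [map_add, map_smul, map_smul, e₁, e₂]
  init := by rw [h₁.init, h₂.init]
  toDual_eq := fun t ht => by
    have h0 : (0 : ℝ) ∈ Icc 0 T := ⟨le_rfl, ht.1.trans ht.2⟩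
    have hv : P.velocity (fun t => c • u₁ t + d • u₂ t) (fun t => c • w₁ t + d • w₂ t) =
        fun t => c • P.velocity u₁ w₁ t + d • P.velocity u₂ w₂ t := by
      funext t
      simp only [velocity, map_add, map_smul, smul_sub]
      abel
    have i₁ := (intervalIntegrable_velocity (P := P) hu₁ h₁.memLp h0 ht).smul c
    have i₂ := (intervalIntegrable_velocity (P := P) hu₂ h₂.memLp h0 ht).smul d
    rw [hv, intervalIntegral.integral_add (by exact i₁) (by exact i₂),
      intervalIntegral.integral_smul, intervalIntegral.integral_smul, toDual_add, toDual_smul,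
      toDual_smul, toDual_add, toDual_smul, toDual_smul, h₁.toDual_eq t ht, h₂.toDual_eq t ht,
      smul_add, smul_add]
    abel

end Linear

/-- The energy identity for trajectories. -/
theorem IsTrajectory.norm_sq_eq (h : P.IsTrajectory T u x y w)
    (hu : MemLp u 2 (volume.restrict (Ioo 0 T))) {t : ℝ} (ht : t ∈ Icc 0 T) :
    ‖y t‖ ^ 2 = ‖x‖ ^ 2 + 2 * ∫ s in Ioo 0 t, P.velocity u w s (w s) := by
  have h' := h.mono ht.2
  have hu' : MemLp u 2 (volume.restrict (Ioo 0 t)) := hu.mono_Ioo ht.2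
  have hv := memLp_velocity (P := P) hu' h'.memLp
  have hd : ∀ s ∈ Icc 0 t, (innerSL ℝ (y s)).comp P.ι =
      (innerSL ℝ (y 0)).comp P.ι + ∫ r in (0 : ℝ)..s, P.velocity u w r := fun s hs => by
    rw [h.init]
    exact h'.toDual_eq s hs
  rw [← h.init]
  exact norm_sq_eq_add_two_mul_setIntegral P.ι ht.1 h'.continuousOn h'.memLp hv h'.ae_eq hd

/-- Two trajectories with the same initial value are close if their data are. -/
theorem IsTrajectory.norm_sub_sq_le {u₁ u₂ : ℝ → Lp ℝ 2 ϱ} {y₁ y₂ : ℝ → H} {w₁ w₂ : ℝ → V}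
    (h₁ : P.IsTrajectory T u₁ x y₁ w₁)
    (h₂ : P.IsTrajectory T u₂ x y₂ w₂) (hu₁ : MemLp u₁ 2 (volume.restrict (Ioo 0 T)))
    (hu₂ : MemLp u₂ 2 (volume.restrict (Ioo 0 T))) {t : ℝ} (ht : t ∈ Icc 0 T) :
    ‖y₁ t - y₂ t‖ ^ 2 ≤ 2 * (√(∫ s in Ioo 0 T, ‖P.velocity u₁ w₁ s - P.velocity u₂ w₂ s‖ ^ 2) *
      √(∫ s in Ioo 0 T, ‖w₁ s - w₂ s‖ ^ 2)) := by
  have h := h₁.smul_add_smul h₂ hu₁ hu₂ 1 (-1)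
  have hu : MemLp (fun t => (1 : ℝ) • u₁ t + (-1 : ℝ) • u₂ t) 2 (volume.restrict (Ioo 0 T)) :=
    hu₁.smul_add_smul hu₂ 1 (-1)
  have h3 := h.norm_sq_eq hu ht
  have hv : ∀ s, P.velocity (fun t => (1 : ℝ) • u₁ t + (-1 : ℝ) • u₂ t)
      (fun t => (1 : ℝ) • w₁ t + (-1 : ℝ) • w₂ t) s =
      P.velocity u₁ w₁ s - P.velocity u₂ w₂ s := fun s => by
    simp only [velocity, one_smul, neg_smul, map_add, map_neg]
    abel
  simp only [hv] at h3
  simp only [one_smul, neg_smul, add_neg_cancel, norm_zero, ← sub_eq_add_neg] at h3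
  rw [h3]
  have hvd : MemLp (fun s => P.velocity u₁ w₁ s - P.velocity u₂ w₂ s) 2
      (volume.restrict (Ioo 0 T)) := (memLp_velocity hu₁ h₁.memLp).sub (memLp_velocity hu₂ h₂.memLp)
  have hwd : MemLp (fun s => w₁ s - w₂ s) 2 (volume.restrict (Ioo 0 T)) := h₁.memLp.sub h₂.memLp
  have hint := hvd.integrable_norm_mul_norm hwd
  have hsub : Ioo 0 t ⊆ Ioo 0 T := Ioo_subset_Ioo_right ht.2
  have hb : ∫ s in Ioo 0 t, (P.velocity u₁ w₁ s - P.velocity u₂ w₂ s) (w₁ s - w₂ s) ≤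
      ∫ s in Ioo 0 t, ‖P.velocity u₁ w₁ s - P.velocity u₂ w₂ s‖ * ‖w₁ s - w₂ s‖ :=
    (Real.le_norm_self _).trans (norm_integral_le_of_norm_le (IntegrableOn.mono_set hint hsub)
      (Eventually.of_forall fun s => ContinuousLinearMap.le_opNorm _ _))
  have hc : ∫ s in Ioo 0 t, ‖P.velocity u₁ w₁ s - P.velocity u₂ w₂ s‖ * ‖w₁ s - w₂ s‖ ≤
      ∫ s in Ioo 0 T, ‖P.velocity u₁ w₁ s - P.velocity u₂ w₂ s‖ * ‖w₁ s - w₂ s‖ :=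
    setIntegral_mono_set hint (Eventually.of_forall fun s => by positivity) hsub.eventuallyLE
  have hd := hvd.integral_norm_mul_norm_le hwd
  linarith

end ControlProblem

/-! ### A priori bounds. -/

/-- An integral form of Grönwall's inequality, bounding the integral of the function. -/
theorem intervalIntegral_le_gronwallBound {N : ℝ → ℝ} {T c K : ℝ} (hN : ContinuousOn N (Icc 0 T))
    (hN0 : ∀ t ∈ Icc 0 T, 0 ≤ N t) (h : ∀ t ∈ Icc 0 T, N t ≤ K * (∫ s in (0 : ℝ)..t, N s) + c)
    {t : ℝ} (ht : t ∈ Icc 0 T) : ∫ s in (0 : ℝ)..t, N s ≤ gronwallBound 0 K c t := by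
  have hint : IntegrableOn N (Ioo 0 T) := hN.integrableOn_Icc.mono_set Ioo_subset_Icc_self
  have hnn : ∀ t ∈ Icc 0 T, 0 ≤ ∫ s in (0 : ℝ)..t, N s := fun t ht =>
    intervalIntegral.integral_nonneg ht.1 fun s hs => hN0 s ⟨hs.1, hs.2.trans ht.2⟩
  have key := norm_le_gronwallBound_of_norm_deriv_right_le
    (f := fun t => ∫ s in (0 : ℝ)..t, N s) (f' := N) (δ := 0) (K := K) (ε := c) (a := 0) (b := T)
    (continuousOn_primitive_Icc hint) (fun x hx => ?_) (by simp) (fun x hx => ?_) t ht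
  · simpa only [Real.norm_of_nonneg (hnn t ht), sub_zero] using key
  · have hx' := Ico_subset_Icc_self hx
    have hmem : Icc 0 T ∈ 𝓝[>] x := mem_of_superset (Ioo_mem_nhdsGT hx.2)
      fun s hs => ⟨hx.1.trans hs.1.le, hs.2.le⟩
    refine intervalIntegral.integral_hasDerivWithinAt_right
      (hint.intervalIntegrable_of_mem_Icc ⟨le_rfl, hx.1.trans hx.2.le⟩ hx')
      ⟨Icc 0 T, hmem, hN.aestronglyMeasurable measurableSet_Icc⟩
      ((hN x hx').mono_of_mem_nhdsWithin hmem)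
  · have hx' := Ico_subset_Icc_self hx
    rw [Real.norm_of_nonneg (hN0 x hx'), Real.norm_of_nonneg (hnn x hx')]
    exact h x hx'

/-- The integral of a square integrable function over a short interval is small. -/
theorem MeasureTheory.MemLp.norm_intervalIntegral_le {E : Type*} [NormedAddCommGroup E]
    [NormedSpace ℝ E] {f : ℝ → E} {T a b : ℝ} (hf : MemLp f 2 (volume.restrict (Ioo 0 T)))
    (ha : 0 ≤ a) (hab : a ≤ b) (hb : b ≤ T) :
    ‖∫ s in a..b, f s‖ ≤ √(b - a) * √(∫ s in Ioo 0 T, ‖f s‖ ^ 2) := by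
  have hsub : Ioo a b ⊆ Ioo 0 T := Ioo_subset_Ioo ha hb
  have hf' : MemLp f 2 (volume.restrict (Ioo a b)) :=
    hf.mono_measure (Measure.restrict_mono hsub le_rfl)
  have h1 : MemLp (fun _ : ℝ => (1 : ℝ)) 2 (volume.restrict (Ioo a b)) := memLp_const 1
  have h2 := h1.integral_norm_mul_norm_le hf'
  simp only [norm_one, one_mul, one_pow, integral_const, smul_eq_mul, mul_one,
    MeasurableSet.univ, measureReal_restrict_apply, univ_inter, Real.volume_real_Ioo_of_le hab]
    at h2
  have h3 : ∫ s in Ioo a b, ‖f s‖ ^ 2 ≤ ∫ s in Ioo 0 T, ‖f s‖ ^ 2 :=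
    setIntegral_mono_set hf.integrable_norm_sq (Eventually.of_forall fun s => by positivity)
      hsub.eventuallyLE
  rw [intervalIntegral.integral_of_le hab, integral_Ioc_eq_integral_Ioo]
  exact (norm_integral_le_integral_norm _).trans (h2.trans (by gcongr))

namespace ControlProblem

variable {V H : Type*}
    [NormedAddCommGroup V] [InnerProductSpace ℝ V] [NormedAddCommGroup H] [InnerProductSpace ℝ H]
    {ω : Type*} [MeasurableSpace ω] {ϱ : Measure ω} {P : ControlProblem V H ϱ}

/-- The energy estimate: trajectories of admissible controls are bounded in `L²((0,T); V)`,
uniformly for bounded `T`. -/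
theorem exists_forall_setIntegral_norm_sq_le
    (hgarding : ∃ α₀ > (0 : ℝ), ∃ ω₀ ≥ (0 : ℝ), ∀ v : V,
      α₀ * ‖v‖ ^ 2 ≤ P.a v v + ω₀ * ‖P.ι v‖ ^ 2)
    (hbdd : Bornology.IsBounded P.Uad) (x : H) {T₀ : ℝ} (hT₀ : 0 ≤ T₀) :
    ∃ C : ℝ, ∀ T u y w, T ∈ Icc 0 T₀ → P.IsAdmissible T u → P.IsTrajectory T u x y w →
      ∫ s in Ioo 0 T, ‖w s‖ ^ 2 ≤ C := by
  obtain ⟨α, hα, κ, hκ, hG⟩ := hgarding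
  obtain ⟨M, hM0, hM⟩ := hbdd.exists_pos_norm_le
  -- The constant in Young's inequality: it absorbs the control term at the cost of `α * ‖w s‖ ^ 2`,
  -- half of the coercivity.
  set L := (‖P.B‖ * M) ^ 2 / α with hL
  have hL0 : 0 ≤ L := by positivity
  set c := ‖x‖ ^ 2 + L * T₀ with hc
  have hc0 : 0 ≤ c := by positivity
  refine ⟨(c + 2 * κ * gronwallBound 0 (2 * κ) c T₀) / α, fun T u y w hT hu hw => ?_⟩
  have hN : ContinuousOn (fun t => ‖y t‖ ^ 2) (Icc 0 T) := hw.continuousOn.norm.pow 2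
  have hNi : IntegrableOn (fun t => ‖y t‖ ^ 2) (Ioo 0 T) :=
    hN.integrableOn_Icc.mono_set Ioo_subset_Icc_self
  have hwi := hw.memLp.integrable_norm_sq
  have hpt : ∀ᵐ s ∂volume.restrict (Ioo 0 T),
      2 * P.velocity u w s (w s) ≤ L - α * ‖w s‖ ^ 2 + 2 * κ * ‖y s‖ ^ 2 := by
    filter_upwards [hu.2, hw.ae_eq] with s h1 h2
    have h3 : P.B (u s) (w s) ≤ ‖P.B‖ * M * ‖w s‖ :=
      (Real.le_norm_self _).trans ((P.B.le_opNorm₂ _ _).trans (by gcongr; exact hM _ h1))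
    have h4 := hG (w s)
    rw [h2] at h4
    have h5 : 2 * (‖P.B‖ * M * ‖w s‖) ≤ L + α * ‖w s‖ ^ 2 := by
      have h6 : L + α * ‖w s‖ ^ 2 - 2 * (‖P.B‖ * M * ‖w s‖) =
          (‖P.B‖ * M - α * ‖w s‖) ^ 2 / α := by
        rw [hL]
        field_simp
        ring
      have h7 : 0 ≤ (‖P.B‖ * M - α * ‖w s‖) ^ 2 / α := by positivity
      linarith
    have h8 : P.velocity u w s (w s) = P.B (u s) (w s) - P.a (w s) (w s) := rfl
    rw [h8]
    linarith
  have hest : ∀ t ∈ Icc 0 T, ‖y t‖ ^ 2 + α * ∫ s in Ioo 0 t, ‖w s‖ ^ 2 ≤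
      2 * κ * (∫ s in (0 : ℝ)..t, ‖y s‖ ^ 2) + c := by
    intro t ht
    have hsub : Ioo 0 t ⊆ Ioo 0 T := Ioo_subset_Ioo_right ht.2
    have e1 := hw.norm_sq_eq hu.1 ht
    have i1 : IntegrableOn (fun s => α * ‖w s‖ ^ 2) (Ioo 0 t) :=
      IntegrableOn.mono_set (hwi.const_mul α) hsub
    have i2 : IntegrableOn (fun s => 2 * κ * ‖y s‖ ^ 2) (Ioo 0 t) :=
      IntegrableOn.mono_set (hNi.const_mul (2 * κ)) hsub
    have i0 : IntegrableOn (fun _ : ℝ => L) (Ioo 0 t) := integrableOn_const (by simp)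
    have i3 : IntegrableOn (fun s => L - α * ‖w s‖ ^ 2) (Ioo 0 t) := i0.sub i1
    have i4 : IntegrableOn (fun s => P.velocity u w s (w s)) (Ioo 0 t) :=
      IntegrableOn.mono_set ((memLp_velocity hu.1 hw.memLp).integrable_apply hw.memLp) hsub
    have e2 : ∫ s in Ioo 0 t, 2 * P.velocity u w s (w s) ≤
        ∫ s in Ioo 0 t, (L - α * ‖w s‖ ^ 2 + 2 * κ * ‖y s‖ ^ 2) :=
      integral_mono_ae (i4.const_mul 2) (i3.add i2)
        (ae_mono (Measure.restrict_mono hsub le_rfl) hpt)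
    rw [integral_const_mul, integral_add i3 i2, integral_sub i0 i1, integral_const_mul,
      integral_const_mul, setIntegral_const, Real.volume_real_Ioo_of_le ht.1, smul_eq_mul,
      sub_zero] at e2
    rw [intervalIntegral.integral_of_le ht.1, integral_Ioc_eq_integral_Ioo]
    have e3 : t * L ≤ L * T₀ := by
      rw [mul_comm]
      exact mul_le_mul_of_nonneg_left (ht.2.trans hT.2) hL0
    linarith
  have hT' : T ∈ Icc 0 T := ⟨hT.1, le_rfl⟩
  -- Grönwall is applied after dropping the `V`-norm term; the full estimate at `T` then returns the
  -- bound on that term.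
  have hg := intervalIntegral_le_gronwallBound hN (fun t _ => by positivity)
    (fun t ht => (le_add_of_nonneg_right (by
      have : 0 ≤ ∫ s in Ioo 0 t, ‖w s‖ ^ 2 := integral_nonneg fun s => by positivity
      positivity)).trans (hest t ht)) hT'
  have hmono := gronwallBound_mono le_rfl hc0 (by positivity : 0 ≤ 2 * κ) hT.2
  have hfin := hest T hT'
  rw [le_div_iff₀ hα]
  have : 2 * κ * (∫ s in (0 : ℝ)..T, ‖y s‖ ^ 2) ≤ 2 * κ * gronwallBound 0 (2 * κ) c T₀ := by
    gcongr
    exact hg.trans hmono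
  nlinarith [sq_nonneg ‖y T‖]

end ControlProblem

/-! ### Cauchy selections from nested convex sets. -/

section Nested

/-- A decreasing sequence of nonempty convex sets, the first of which is bounded, in an inner
product space admits a Cauchy selection: take elements of almost minimal norm. -/
theorem exists_cauchySeq_mem_of_antitone {E : Type*} [NormedAddCommGroup E]
    [InnerProductSpace ℝ E] {S : ℕ → Set E} (hanti : Antitone S) (hconv : ∀ n, Convex ℝ (S n))
    (hne : ∀ n, (S n).Nonempty) (hbdd : Bornology.IsBounded (S 0)) :
    ∃ x : ℕ → E, (∀ n, x n ∈ S n) ∧ CauchySeq x := by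
  obtain ⟨M, hM⟩ := hbdd.exists_norm_le
  set d : ℕ → ℝ := fun n => sInf ((fun z : E => ‖z‖ ^ 2) '' S n) with hd
  have hbelow : ∀ n, BddBelow ((fun z : E => ‖z‖ ^ 2) '' S n) := fun n =>
    ⟨0, by rintro _ ⟨z, -, rfl⟩; positivity⟩
  have hd_le : ∀ n, ∀ z ∈ S n, d n ≤ ‖z‖ ^ 2 := fun n z hz => csInf_le (hbelow n) ⟨z, hz, rfl⟩
  have hmono : Monotone d := fun m n hmn =>
    csInf_le_csInf (hbelow m) ((hne n).image _) (image_mono (hanti hmn))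
  have hbd : BddAbove (range d) := by
    refine ⟨M ^ 2, ?_⟩
    rintro _ ⟨n, rfl⟩
    obtain ⟨z, hz⟩ := hne n
    exact (hd_le n z hz).trans
      (pow_le_pow_left₀ (norm_nonneg z) (hM z (hanti (Nat.zero_le n) hz)) 2)
  have htend := tendsto_atTop_ciSup hmono hbd
  have hD : ∀ n, d n ≤ ⨆ k, d k := le_ciSup hbd
  have hex : ∀ n : ℕ, ∃ z ∈ S n, ‖z‖ ^ 2 < d n + 1 / ((n : ℝ) + 1) := by
    intro n
    obtain ⟨_, ⟨z, hz, rfl⟩, h⟩ := exists_lt_of_csInf_lt ((hne n).image fun z : E => ‖z‖ ^ 2)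
      (lt_add_of_pos_right (d n) (Nat.one_div_pos_of_nat (α := ℝ) (n := n)))
    exact ⟨z, hz, h⟩
  choose x hxS hx using hex
  refine ⟨x, hxS, ?_⟩
  have hkey : ∀ n m, n ≤ m →
      dist (x n) (x m) ≤ √(2 * ((⨆ k, d k) - d n) + 4 * (1 / ((n : ℝ) + 1))) := by
    intro n m hnm
    -- The midpoint has squared norm at least `d n`, so the parallelogram law bounds the squared
    -- distance by `2 * (d m - d n)` plus the selection errors.
    have hmid : (2 : ℝ)⁻¹ • x n + (2 : ℝ)⁻¹ • x m ∈ S n :=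
      hconv n (hxS n) (hanti hnm (hxS m)) (by norm_num) (by norm_num) (by norm_num)
    have h1 := hd_le n _ hmid
    rw [← smul_add, norm_smul, mul_pow] at h1
    have h2 := parallelogram_law_with_norm ℝ (x n) (x m)
    have h3 : (1 : ℝ) / ((m : ℝ) + 1) ≤ 1 / ((n : ℝ) + 1) := Nat.one_div_le_one_div hnm
    have h4 := hx n
    have h5 := hx m
    have h6 := hD m
    rw [dist_eq_norm]
    refine Real.le_sqrt_of_sq_le ?_
    norm_num at h1
    nlinarith
  refine cauchySeq_of_le_tendsto_0
    (fun n : ℕ => √(2 * ((⨆ k, d k) - d n) + 4 * (1 / ((n : ℝ) + 1)))) ?_ ?_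
  · have hstep : ∀ n m N, N ≤ n → n ≤ m →
        dist (x n) (x m) ≤ √(2 * ((⨆ k, d k) - d N) + 4 * (1 / ((N : ℝ) + 1))) := by
      intro n m N hn hnm
      refine (hkey n m hnm).trans (Real.sqrt_le_sqrt ?_)
      have h1 := hmono hn
      have h2 : (1 : ℝ) / ((n : ℝ) + 1) ≤ 1 / ((N : ℝ) + 1) := Nat.one_div_le_one_div hn
      linarith
    intro n m N hn hm
    rcases le_total n m with h | h
    · exact hstep n m N hn h
    · rw [dist_comm]
      exact hstep m n N hm h
  · have h1 : Tendsto (fun n : ℕ => 2 * ((⨆ k, d k) - d n) + 4 * (1 / ((n : ℝ) + 1))) atTop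
        (𝓝 (2 * ((⨆ k, d k) - ⨆ k, d k) + 4 * 0)) :=
      ((tendsto_const_nhds.sub htend).const_mul 2).add
        (tendsto_one_div_add_atTop_nhds_zero_nat.const_mul 4)
    have h2 := h1.sqrt
    simpa using h2

/-- The product carries the sup norm, for which the parallelogram law fails, so the argument is run
in the equivalent `WithLp 2` norm. -/
theorem exists_cauchySeq_mem_of_antitone_prod {E F G : Type*}
    [NormedAddCommGroup E] [InnerProductSpace ℝ E] [NormedAddCommGroup F] [InnerProductSpace ℝ F]
    [NormedAddCommGroup G] [InnerProductSpace ℝ G] {S : ℕ → Set (E × F × G)}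
    (hanti : Antitone S) (hconv : ∀ n, Convex ℝ (S n))
    (hne : ∀ n, (S n).Nonempty) (hbdd : Bornology.IsBounded (S 0)) :
    ∃ x : ℕ → E × F × G, (∀ n, x n ∈ S n) ∧ CauchySeq x := by
  let e : WithLp 2 (E × WithLp 2 (F × G)) ≃L[ℝ] E × F × G :=
    (WithLp.prodContinuousLinearEquiv 2 ℝ E (WithLp 2 (F × G))).trans
      ((ContinuousLinearEquiv.refl ℝ E).prodCongr (WithLp.prodContinuousLinearEquiv 2 ℝ F G))
  obtain ⟨x, hx, hc⟩ := exists_cauchySeq_mem_of_antitone (S := fun n => e ⁻¹' S n)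
    (fun m n h => preimage_mono (hanti h))
    (fun n => (hconv n).linear_preimage e.toLinearEquiv.toLinearMap)
    (fun n => (hne n).preimage e.surjective)
    (by
      change Bornology.IsBounded (e ⁻¹' S 0)
      rw [← e.image_symm_eq_preimage]
      exact e.symm.lipschitz.isBounded_image hbdd)
  exact ⟨fun n => e (x n), hx, hc.map e.toContinuousLinearMap.uniformContinuous⟩

end Nested

/-! ### Norms and almost everywhere limits in `L²`. -/

section LpHelpers

variable {α : Type*} [MeasurableSpace α] {μ : Measure α} {E : Type*} [NormedAddCommGroup E]

theorem MeasureTheory.Lp.norm_sq_eq_integral (f : Lp E 2 μ) : ‖f‖ ^ 2 = ∫ x, ‖f x‖ ^ 2 ∂μ := by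
  have := (Lp.memLp f).norm_toLp_sq
  rwa [Lp.toLp_coeFn] at this

theorem MeasureTheory.Lp.sqrt_integral_norm_sub_sq (f g : Lp E 2 μ) {f' g' : α → E}
    (hf : f =ᵐ[μ] f') (hg : g =ᵐ[μ] g') : √(∫ x, ‖f' x - g' x‖ ^ 2 ∂μ) = ‖f - g‖ := by
  rw [← Real.sqrt_sq (norm_nonneg (f - g)), Lp.norm_sq_eq_integral]
  congr 1
  refine integral_congr_ae ?_
  filter_upwards [hf, hg, Lp.coeFn_sub f g] with x h1 h2 h3
  rw [h3, Pi.sub_apply, h1, h2]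

theorem MeasureTheory.Lp.exists_subseq_tendsto_ae {f : ℕ → Lp E 2 μ} {g : Lp E 2 μ}
    (h : Tendsto f atTop (𝓝 g)) : ∃ ns : ℕ → ℕ, StrictMono ns ∧
      ∀ᵐ x ∂μ, Tendsto (fun i => f (ns i) x) atTop (𝓝 (g x)) :=
  (tendstoInMeasure_of_tendsto_Lp h).exists_seq_tendsto_ae

end LpHelpers

namespace ControlProblem

variable {V H : Type*}
    [NormedAddCommGroup V] [InnerProductSpace ℝ V] [NormedAddCommGroup H] [InnerProductSpace ℝ H]
    {ω : Type*} [MeasurableSpace ω] {ϱ : Measure ω} {P : ControlProblem V H ϱ}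

theorem convex_Uad : Convex ℝ P.Uad := by
  intro u hu v hv a b ha hb hab
  have h0 : ∀ᵐ x ∂ϱ, P.ua x ≤ u x ∧ u x ≤ P.ub x := hu
  have h1 : ∀ᵐ x ∂ϱ, P.ua x ≤ v x ∧ v x ≤ P.ub x := hv
  change ∀ᵐ x ∂ϱ, P.ua x ≤ (a • u + b • v : Lp ℝ 2 ϱ) x ∧ (a • u + b • v : Lp ℝ 2 ϱ) x ≤ P.ub x
  filter_upwards [h0, h1, Lp.coeFn_add (a • u) (b • v), Lp.coeFn_smul a u, Lp.coeFn_smul b v]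
    with x hx hy h2 h3 h4
  rw [h2, Pi.add_apply, h3, h4]
  exact convex_Icc (P.ua x) (P.ub x) hx hy ha hb hab

theorem isClosed_Uad : IsClosed P.Uad := by
  refine IsSeqClosed.isClosed fun u v hu huv => ?_
  obtain ⟨ns, -, hns⟩ := Lp.exists_subseq_tendsto_ae huv
  have h0 : ∀ᵐ x ∂ϱ, ∀ n, P.ua x ≤ u n x ∧ u n x ≤ P.ub x := ae_all_iff.2 hu
  change ∀ᵐ x ∂ϱ, P.ua x ≤ v x ∧ v x ≤ P.ub x
  filter_upwards [h0, hns] with x hx hlim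
  exact isClosed_Icc.mem_of_tendsto hlim (Eventually.of_forall fun i => hx (ns i))

/-- The time derivative of a trajectory as an element of `L²((0,T); V*)`. -/
noncomputable def velocityLp (P : ControlProblem V H ϱ) {μ : Measure ℝ} (w : Lp V 2 μ)
    (u : Lp (Lp ℝ 2 ϱ) 2 μ) : Lp (V →L[ℝ] ℝ) 2 μ :=
  P.B.compLpL 2 μ u - P.a.compLpL 2 μ w

theorem coeFn_velocityLp {μ : Measure ℝ} (w : Lp V 2 μ) (u : Lp (Lp ℝ 2 ϱ) 2 μ) :
    P.velocityLp w u =ᵐ[μ] P.velocity u w := by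
  filter_upwards [Lp.coeFn_sub (P.B.compLpL 2 μ u) (P.a.compLpL 2 μ w),
    P.B.coeFn_compLpL u, P.a.coeFn_compLpL w] with t h1 h2 h3
  rw [velocityLp, h1, Pi.sub_apply, h2, h3, velocity]

theorem tendsto_velocityLp {μ : Measure ℝ} {wn : ℕ → Lp V 2 μ} {w : Lp V 2 μ}
    {un : ℕ → Lp (Lp ℝ 2 ϱ) 2 μ} {u : Lp (Lp ℝ 2 ϱ) 2 μ} (hw : Tendsto wn atTop (𝓝 w))
    (hu : Tendsto un atTop (𝓝 u)) :
    Tendsto (fun n => P.velocityLp (wn n) (un n)) atTop (𝓝 (P.velocityLp w u)) := by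
  have h1 := ((P.B.compLpL 2 μ).continuous.tendsto u).comp hu
  have h2 := ((P.a.compLpL 2 μ).continuous.tendsto w).comp hw
  exact h1.sub h2

end ControlProblem

/-! ### Almost reaching trajectories and their limits. -/

namespace ControlProblem

variable {V H : Type*}
    [NormedAddCommGroup V] [InnerProductSpace ℝ V] [NormedAddCommGroup H] [InnerProductSpace ℝ H]
    {ω : Type*} [MeasurableSpace ω] {ϱ : Measure ω} {P : ControlProblem V H ϱ}

/-- Trajectories on `[0, T]` of admissible controls, together with a point `h` of the ball of
radius `r` around `yd` that is `ε`-close in `V*` to the endpoint of the trajectory. -/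
def almostReaching (P : ControlProblem V H ϱ) (T r ε : ℝ) :
    Set (Lp V 2 (volume.restrict (Ioo 0 T)) × Lp (Lp ℝ 2 ϱ) 2 (volume.restrict (Ioo 0 T)) × H) :=
  {p | (∀ᵐ t ∂volume.restrict (Ioo 0 T), p.2.1 t ∈ P.Uad) ∧ ‖p.2.2 - P.yd‖ ≤ r ∧
    ∃ y, P.IsTrajectory T p.2.1 P.y₀ y p.1 ∧ ‖P.toDual (y T - p.2.2)‖ ≤ ε}

theorem almostReaching_mono {T r ε ε' : ℝ} (h : ε ≤ ε') :
    P.almostReaching T r ε ⊆ P.almostReaching T r ε' :=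
  fun _ hp => ⟨hp.1, hp.2.1, hp.2.2.imp fun _ hy => ⟨hy.1, hy.2.trans h⟩⟩

/-- The state equation is linear and all trajectories start at the same `y₀`, so convex combinations
remain trajectories from `y₀`; the other constraints are convex. -/
theorem convex_almostReaching {T r ε : ℝ} : Convex ℝ (P.almostReaching T r ε) := by
  rintro ⟨w₁, u₁, h₁⟩ ⟨hu₁, hr₁, y₁, hy₁, he₁⟩ ⟨w₂, u₂, h₂⟩ ⟨hu₂, hr₂, y₂, hy₂, he₂⟩ a b ha hb hab
  dsimp only at *
  have hcu : ∀ᵐ t ∂volume.restrict (Ioo 0 T),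
      a • u₁ t + b • u₂ t = (a • u₁ + b • u₂ : Lp (Lp ℝ 2 ϱ) 2 _) t := by
    filter_upwards [Lp.coeFn_add (a • u₁) (b • u₂), Lp.coeFn_smul a u₁, Lp.coeFn_smul b u₂]
      with t h1 h2 h3
    rw [h1, Pi.add_apply, h2, h3, Pi.smul_apply, Pi.smul_apply]
  have hcw : ∀ᵐ t ∂volume.restrict (Ioo 0 T),
      a • w₁ t + b • w₂ t = (a • w₁ + b • w₂ : Lp V 2 _) t := by
    filter_upwards [Lp.coeFn_add (a • w₁) (b • w₂), Lp.coeFn_smul a w₁, Lp.coeFn_smul b w₂]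
      with t h1 h2 h3
    rw [h1, Pi.add_apply, h2, h3, Pi.smul_apply, Pi.smul_apply]
  refine ⟨?_, ?_, fun t => a • y₁ t + b • y₂ t, ?_, ?_⟩
  · change ∀ᵐ t ∂volume.restrict (Ioo 0 T), (a • u₁ + b • u₂ : Lp (Lp ℝ 2 ϱ) 2 _) t ∈ P.Uad
    filter_upwards [hcu, hu₁, hu₂] with t h1 h2 h3
    rw [← h1]
    exact convex_Uad h2 h3 ha hb hab
  · have h1 := (convex_closedBall P.yd r) (mem_closedBall_iff_norm.2 hr₁)
      (mem_closedBall_iff_norm.2 hr₂) ha hb hab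
    exact mem_closedBall_iff_norm.1 h1
  · have h1 := hy₁.smul_add_smul hy₂ (Lp.memLp u₁) (Lp.memLp u₂) a b
    rw [← add_smul, hab, one_smul] at h1
    exact h1.congr hcu hcw
  · have h1 : a • y₁ T + b • y₂ T - (a • h₁ + b • h₂) = a • (y₁ T - h₁) + b • (y₂ T - h₂) := by
      simp only [smul_sub]
      abel
    change ‖P.toDual (a • y₁ T + b • y₂ T - (a • h₁ + b • h₂))‖ ≤ ε
    rw [h1, toDual_add, toDual_smul, toDual_smul]
    have h2 := (convex_closedBall (0 : V →L[ℝ] ℝ) ε) (mem_closedBall_zero_iff.2 he₁)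
      (mem_closedBall_zero_iff.2 he₂) ha hb hab
    exact mem_closedBall_zero_iff.1 h2

theorem setIntegral_norm_sq_le_of_forall_Uad {M T : ℝ} (hT : 0 ≤ T) (hM : ∀ v ∈ P.Uad, ‖v‖ ≤ M)
    {u : ℝ → Lp ℝ 2 ϱ} (hu : P.IsAdmissible T u) : ∫ s in Ioo 0 T, ‖u s‖ ^ 2 ≤ M ^ 2 * T := by
  have h1 : ∫ s in Ioo 0 T, ‖u s‖ ^ 2 ≤ ∫ _ in Ioo 0 T, M ^ 2 := by
    refine integral_mono_ae hu.1.integrable_norm_sq (integrableOn_const (by simp)) ?_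
    filter_upwards [hu.2] with s hs
    exact pow_le_pow_left₀ (norm_nonneg _) (hM _ hs) 2
  rwa [setIntegral_const, Real.volume_real_Ioo_of_le hT, smul_eq_mul, sub_zero, mul_comm] at h1

theorem isBounded_almostReaching
    (hgarding : ∃ α₀ > (0 : ℝ), ∃ ω₀ ≥ (0 : ℝ), ∀ v : V,
      α₀ * ‖v‖ ^ 2 ≤ P.a v v + ω₀ * ‖P.ι v‖ ^ 2)
    (hbdd : Bornology.IsBounded P.Uad) {T r ε : ℝ} (hT : 0 ≤ T) :
    Bornology.IsBounded (P.almostReaching T r ε) := by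
  obtain ⟨C, hC⟩ := exists_forall_setIntegral_norm_sq_le hgarding hbdd P.y₀ hT
  obtain ⟨M, hM⟩ := hbdd.exists_norm_le
  refine isBounded_iff_forall_norm_le.2
    ⟨max (√C) (max (√(M ^ 2 * T)) (r + ‖P.yd‖)), fun p hp => ?_⟩
  obtain ⟨hu, hr, y, hy, -⟩ := hp
  have hadm : P.IsAdmissible T p.2.1 := ⟨Lp.memLp _, hu⟩
  refine max_le_max ?_ (max_le_max ?_ ?_)
  · refine Real.le_sqrt_of_sq_le ?_
    rw [Lp.norm_sq_eq_integral]
    exact hC T _ y _ ⟨hT, le_rfl⟩ hadm hy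
  · refine Real.le_sqrt_of_sq_le ?_
    rw [Lp.norm_sq_eq_integral]
    exact setIntegral_norm_sq_le_of_forall_Uad hT hM hadm
  · have := norm_add_le (p.2.2 - P.yd) P.yd
    rw [sub_add_cancel] at this
    linarith

/-- Limits of trajectories, in the topology of `L²((0,T); V) × L²((0,T); L²(ω))`. -/
theorem exists_isTrajectory_of_tendsto [CompleteSpace H] {T : ℝ} (hT : 0 ≤ T) {x : H}
    {wn : ℕ → Lp V 2 (volume.restrict (Ioo 0 T))} {w : Lp V 2 (volume.restrict (Ioo 0 T))}
    {un : ℕ → Lp (Lp ℝ 2 ϱ) 2 (volume.restrict (Ioo 0 T))}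
    {u : Lp (Lp ℝ 2 ϱ) 2 (volume.restrict (Ioo 0 T))} {yn : ℕ → ℝ → H}
    (hy : ∀ n, P.IsTrajectory T (un n) x (yn n) (wn n))
    (hw : Tendsto wn atTop (𝓝 w)) (hu : Tendsto un atTop (𝓝 u)) :
    ∃ y, P.IsTrajectory T u x y w ∧ ∀ t ∈ Icc 0 T, Tendsto (fun n => yn n t) atTop (𝓝 (y t)) := by
  have hF : Tendsto (fun n => P.velocityLp (wn n) (un n)) atTop (𝓝 (P.velocityLp w u)) :=
    tendsto_velocityLp hw hu
  have hdist : ∀ m n, ∀ t ∈ Icc 0 T, dist (yn m t) (yn n t) ^ 2 ≤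
      2 * (dist (P.velocityLp (wn m) (un m)) (P.velocityLp (wn n) (un n)) *
        dist (wn m) (wn n)) := by
    intro m n t ht
    have h1 := (hy m).norm_sub_sq_le (hy n) (Lp.memLp _) (Lp.memLp _) ht
    rw [Lp.sqrt_integral_norm_sub_sq _ _ (coeFn_velocityLp (wn m) (un m))
      (coeFn_velocityLp (wn n) (un n)), Lp.sqrt_integral_norm_sub_sq (wn m) (wn n)
        (EventuallyEq.refl _ _) (EventuallyEq.refl _ _)] at h1
    simpa only [dist_eq_norm] using h1
  have hucs : UniformCauchySeqOn yn atTop (Icc 0 T) := by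
    rw [Metric.uniformCauchySeqOn_iff]
    intro ε hε
    obtain ⟨N₁, hN₁⟩ := Metric.cauchySeq_iff.1 hF.cauchySeq (ε / 2) (half_pos hε)
    obtain ⟨N₂, hN₂⟩ := Metric.cauchySeq_iff.1 hw.cauchySeq (ε / 2) (half_pos hε)
    refine ⟨max N₁ N₂, fun m hm n hn t ht => ?_⟩
    have h1 := hN₁ m ((le_max_left _ _).trans hm) n ((le_max_left _ _).trans hn)
    have h2 := hN₂ m ((le_max_right _ _).trans hm) n ((le_max_right _ _).trans hn)
    have h3 := hdist m n t ht
    have h4 := mul_lt_mul'' h1 h2 dist_nonneg dist_nonneg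
    refine lt_of_pow_lt_pow_left₀ 2 hε.le ?_
    nlinarith
  -- The limit state must be a function on all of `ℝ`; its value outside `[0, T]` is irrelevant.
  have hex : ∀ t, ∃ z, t ∈ Icc 0 T → Tendsto (fun n => yn n t) atTop (𝓝 z) := by
    intro t
    by_cases ht : t ∈ Icc 0 T
    · obtain ⟨z, hz⟩ := cauchySeq_tendsto_of_complete (hucs.cauchySeq ht)
      exact ⟨z, fun _ => hz⟩
    · exact ⟨0, fun h => absurd h ht⟩
  choose y hyt using hex
  refine ⟨y, ⟨?_, Lp.memLp w, ?_, ?_, ?_⟩, hyt⟩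
  · exact (hucs.tendstoUniformlyOn_of_tendsto hyt).continuousOn
      (Frequently.of_forall fun n => (hy n).continuousOn)
  · obtain ⟨ns, hns, hlim⟩ := Lp.exists_subseq_tendsto_ae hw
    have hall := ae_all_iff.2 fun n => (hy n).ae_eq
    filter_upwards [hlim, hall, ae_restrict_mem measurableSet_Ioo] with t h1 h2 h3
    refine tendsto_nhds_unique ((P.ι.continuous.tendsto _).comp h1) ?_
    exact ((hyt t (Ioo_subset_Icc_self h3)).comp hns.tendsto_atTop).congr fun i => (h2 (ns i)).symm
  · exact tendsto_nhds_unique (hyt 0 ⟨le_rfl, hT⟩)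
      (tendsto_const_nhds.congr fun n => (hy n).init.symm)
  · intro t ht
    have h1 : Tendsto (fun n => P.toDual (yn n t)) atTop (𝓝 (P.toDual (y t))) :=
      (continuous_toDual.tendsto _).comp (hyt t ht)
    have h2 : Tendsto (fun n => ∫ s in (0 : ℝ)..t, P.velocity (un n) (wn n) s) atTop
        (𝓝 (∫ s in (0 : ℝ)..t, P.velocity u w s)) := by
      have h0 : (0 : ℝ) ∈ Icc 0 T := ⟨le_rfl, ht.1.trans ht.2⟩
      rw [tendsto_iff_norm_sub_tendsto_zero]
      have hb : ∀ n, ‖(∫ s in (0 : ℝ)..t, P.velocity (un n) (wn n) s) -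
          ∫ s in (0 : ℝ)..t, P.velocity u w s‖ ≤
          √(t - 0) * ‖P.velocityLp (wn n) (un n) - P.velocityLp w u‖ := by
        intro n
        have m1 := memLp_velocity (P := P) (Lp.memLp (un n)) (Lp.memLp (wn n))
        have m2 := memLp_velocity (P := P) (Lp.memLp u) (Lp.memLp w)
        rw [← intervalIntegral.integral_sub
          (intervalIntegrable_velocity (Lp.memLp _) (Lp.memLp _) h0 ht)
          (intervalIntegrable_velocity (Lp.memLp _) (Lp.memLp _) h0 ht),
          ← Lp.sqrt_integral_norm_sub_sq _ _ (coeFn_velocityLp (wn n) (un n))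
            (coeFn_velocityLp w u)]
        exact (m1.sub m2).norm_intervalIntegral_le le_rfl ht.1 ht.2
      refine squeeze_zero (fun _ => norm_nonneg _) hb ?_
      simpa using (tendsto_iff_norm_sub_tendsto_zero.1 hF).const_mul (√(t - 0))
    refine tendsto_nhds_unique h1 ?_
    exact (h2.const_add (P.toDual x)).congr fun n => ((hy n).toDual_eq t ht).symm

end ControlProblem

/-! ### Concatenation in time. -/

theorem memLp_ite_concat {E : Type*} [NormedAddCommGroup E] {p : ℝ≥0∞} {S T : ℝ}
    {f g : ℝ → E} (hf : MemLp f p (volume.restrict (Ioo 0 S)))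
    (hg : MemLp g p (volume.restrict (Ioo 0 T))) :
    MemLp (fun t => if t ≤ S then f t else g (t - S)) p (volume.restrict (Ioo 0 (S + T))) := by
  have h1 : MemLp f p ((volume.restrict (Ioo 0 (S + T))).restrict (Iic S)) := by
    rw [Measure.restrict_restrict measurableSet_Iic]
    rw [Measure.restrict_congr_set Ioo_ae_eq_Ioc] at hf
    have h0 : Iic S ∩ Ioo 0 (S + T) ⊆ Ioc 0 S := fun t ht => ⟨ht.2.1, ht.1⟩
    exact hf.mono_measure (Measure.restrict_mono h0 le_rfl)
  have h2 : MemLp (fun t => g (t - S)) p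
      ((volume.restrict (Ioo 0 (S + T))).restrict (Iic S)ᶜ) := by
    rw [Measure.restrict_restrict measurableSet_Iic.compl]
    have h3 := hg.comp_measurePreserving
      ((measurePreserving_sub_right volume S).restrict_preimage measurableSet_Ioo)
    refine h3.mono_measure (Measure.restrict_mono (fun t ht => ?_) le_rfl)
    have h4 : S < t := not_le.1 ht.1
    exact ⟨by linarith, by linarith [ht.2.2]⟩
  classical
  refine (MemLp.piecewise measurableSet_Iic h1 h2).ae_eq (Eventually.of_forall fun t => ?_)
  simp only [piecewise, mem_Iic]

theorem ae_restrict_Ioo_concat {q q₁ q₂ : ℝ → Prop} {S T : ℝ}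
    (h₁ : ∀ᵐ t ∂volume.restrict (Ioo 0 S), q₁ t) (h₂ : ∀ᵐ t ∂volume.restrict (Ioo 0 T), q₂ t)
    (hq₁ : ∀ t ≤ S, q₁ t → q t) (hq₂ : ∀ t, S < t → q₂ (t - S) → q t) :
    ∀ᵐ t ∂volume.restrict (Ioo 0 (S + T)), q t := by
  rw [ae_restrict_iff' measurableSet_Ioo] at *
  have h3 := (measurePreserving_sub_right volume S).quasiMeasurePreserving.ae h₂
  have h4 : ∀ᵐ t : ℝ, t ≠ S := by simp [ae_iff]
  filter_upwards [h₁, h3, h4] with t e1 e2 e3 ht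
  rcases lt_or_gt_of_ne e3 with h | h
  · exact hq₁ t h.le (e1 ⟨ht.1, h⟩)
  · exact hq₂ t h (e2 ⟨by linarith, by linarith [ht.2]⟩)

namespace ControlProblem

variable {V H : Type*}
    [NormedAddCommGroup V] [InnerProductSpace ℝ V] [NormedAddCommGroup H] [InnerProductSpace ℝ H]
    {ω : Type*} [MeasurableSpace ω] {ϱ : Measure ω} {P : ControlProblem V H ϱ}

theorem IsAdmissible.concat {S T : ℝ} {u v : ℝ → Lp ℝ 2 ϱ} (hu : P.IsAdmissible S u)
    (hv : P.IsAdmissible T v) :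
    P.IsAdmissible (S + T) (fun t => if t ≤ S then u t else v (t - S)) :=
  ⟨memLp_ite_concat hu.1 hv.1, ae_restrict_Ioo_concat hu.2 hv.2
    (fun t ht h => by simpa only [if_pos ht] using h)
    (fun t ht h => by simpa only [if_neg (not_le.2 ht)] using h)⟩

theorem IsTrajectory.concat {S T : ℝ} {u v : ℝ → Lp ℝ 2 ϱ} {x : H} {y z : ℝ → H} {w w' : ℝ → V}
    (hS : 0 ≤ S) (hT : 0 ≤ T) (hy : P.IsTrajectory S u x y w)
    (hz : P.IsTrajectory T v (y S) z w') (hu : MemLp u 2 (volume.restrict (Ioo 0 S)))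
    (hv : MemLp v 2 (volume.restrict (Ioo 0 T))) :
    P.IsTrajectory (S + T) (fun t => if t ≤ S then u t else v (t - S)) x
      (fun t => if t ≤ S then y t else z (t - S))
      (fun t => if t ≤ S then w t else w' (t - S)) where
  continuousOn := by
    rw [← Icc_union_Icc_eq_Icc hS (le_add_of_nonneg_right hT)]
    refine ContinuousOn.union_of_isClosed ?_ ?_ isClosed_Icc isClosed_Icc
    · exact hy.continuousOn.congr fun t ht => if_pos ht.2
    · have h1 : ContinuousOn (fun t => z (t - S)) (Icc S (S + T)) :=
        hz.continuousOn.comp (by fun_prop)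
          fun t ht => ⟨by linarith [ht.1], by linarith [ht.2]⟩
      refine h1.congr fun t ht => ?_
      rcases ht.1.eq_or_lt with rfl | h
      · simp [hz.init]
      · exact if_neg (not_le.2 h)
  memLp := memLp_ite_concat hy.memLp hz.memLp
  ae_eq := ae_restrict_Ioo_concat hy.ae_eq hz.ae_eq
    (fun t ht h => by simpa only [if_pos ht] using h)
    (fun t ht h => by simpa only [if_neg (not_le.2 ht)] using h)
  init := by simp only [if_pos hS, hy.init]
  toDual_eq := fun t ht => by
    have hsm : ∀ s ≤ S, P.velocity (fun t => if t ≤ S then u t else v (t - S))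
        (fun t => if t ≤ S then w t else w' (t - S)) s = P.velocity u w s := fun s hs => by
      simp only [velocity, if_pos hs]
    have hlg : ∀ s, S < s → P.velocity (fun t => if t ≤ S then u t else v (t - S))
        (fun t => if t ≤ S then w t else w' (t - S)) s = P.velocity v w' (s - S) :=
      fun s hs => by simp only [velocity, if_neg (not_le.2 hs)]
    have hcong : ∀ t ∈ Icc 0 S, ∫ s in (0 : ℝ)..t,
        P.velocity (fun t => if t ≤ S then u t else v (t - S))
          (fun t => if t ≤ S then w t else w' (t - S)) s =
        ∫ s in (0 : ℝ)..t, P.velocity u w s := fun t ht =>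
      intervalIntegral.integral_congr fun s hs => by
        rw [uIcc_of_le ht.1] at hs
        exact hsm s (hs.2.trans ht.2)
    rcases le_or_gt t S with h | h
    · simp only [if_pos h]
      rw [hcong t ⟨ht.1, h⟩]
      exact hy.toDual_eq t ⟨ht.1, h⟩
    · simp only [if_neg (not_le.2 h)]
      have hmem := memLp_velocity (P := P) (memLp_ite_concat hu hv)
        (memLp_ite_concat hy.memLp hz.memLp)
      have hi := hmem.integrable one_le_two
      have h0 : (0 : ℝ) ∈ Icc 0 (S + T) := ⟨le_rfl, by positivity⟩
      have hS' : S ∈ Icc 0 (S + T) := ⟨hS, by linarith⟩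
      rw [hz.toDual_eq (t - S) ⟨by linarith, by linarith [ht.2]⟩,
        hy.toDual_eq S ⟨hS, le_rfl⟩, ← intervalIntegral.integral_add_adjacent_intervals
          (IntegrableOn.intervalIntegrable_of_mem_Icc hi h0 hS')
          (IntegrableOn.intervalIntegrable_of_mem_Icc hi hS' ht), hcong S ⟨hS, le_rfl⟩, add_assoc]
      congr 2
      have e1 : ∫ s in S..t, P.velocity (fun t => if t ≤ S then u t else v (t - S))
          (fun t => if t ≤ S then w t else w' (t - S)) s =
          ∫ s in S..t, P.velocity v w' (s - S) := by
        -- The half-open interval omits `s = S`, where the first branch is still in force.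
        refine intervalIntegral.integral_congr_ae (Eventually.of_forall fun s hs => ?_)
        rw [uIoc_of_le h.le] at hs
        exact hlg s hs.1
      rw [e1, intervalIntegral.integral_comp_sub_right (P.velocity v w'), sub_self]

/-! ### Existence of optimal trajectories and the value function. -/

/-- The velocity is `B u - A w`, and both parts are bounded in `L²`. Uniformity in `T`, `u` and `y`
is what makes trajectories equicontinuous in `V*`. -/
theorem exists_forall_sqrt_velocity_le
    (hgarding : ∃ α₀ > (0 : ℝ), ∃ ω₀ ≥ (0 : ℝ), ∀ v : V,
      α₀ * ‖v‖ ^ 2 ≤ P.a v v + ω₀ * ‖P.ι v‖ ^ 2)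
    (hbdd : Bornology.IsBounded P.Uad) (x : H) {T₀ : ℝ} (hT₀ : 0 ≤ T₀) :
    ∃ K > 0, ∀ T u y w, T ∈ Icc 0 T₀ → P.IsAdmissible T u → P.IsTrajectory T u x y w →
      √(∫ s in Ioo 0 T, ‖P.velocity u w s‖ ^ 2) ≤ K := by
  obtain ⟨C, hC⟩ := exists_forall_setIntegral_norm_sq_le hgarding hbdd x hT₀
  obtain ⟨M, hM⟩ := hbdd.exists_norm_le
  -- The summand `1` keeps the bound positive, since it will be divided by.
  refine ⟨√(2 * ‖P.B‖ ^ 2 * (M ^ 2 * T₀) + 2 * ‖P.a‖ ^ 2 * C) + 1, by positivity,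
    fun T u y w hT hu hw => (Real.sqrt_le_sqrt ?_).trans (le_add_of_nonneg_right zero_le_one)⟩
  have h1 := hC T u y w hT hu hw
  have h2 := setIntegral_norm_sq_le_of_forall_Uad hT.1 hM hu
  have i1 := hu.1.integrable_norm_sq.const_mul (2 * ‖P.B‖ ^ 2)
  have i2 := hw.memLp.integrable_norm_sq.const_mul (2 * ‖P.a‖ ^ 2)
  calc ∫ s in Ioo 0 T, ‖P.velocity u w s‖ ^ 2
      ≤ ∫ s in Ioo 0 T, (2 * ‖P.B‖ ^ 2 * ‖u s‖ ^ 2 + 2 * ‖P.a‖ ^ 2 * ‖w s‖ ^ 2) := by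
        refine integral_mono (memLp_velocity hu.1 hw.memLp).integrable_norm_sq (i1.add i2)
          fun s => ?_
        have h3 : ‖P.velocity u w s‖ ≤ ‖P.B‖ * ‖u s‖ + ‖P.a‖ * ‖w s‖ :=
          (norm_sub_le _ _).trans (add_le_add (P.B.le_opNorm _) (P.a.le_opNorm _))
        have h4 := pow_le_pow_left₀ (norm_nonneg _) h3 2
        have h5 := sq_nonneg (‖P.B‖ * ‖u s‖ - ‖P.a‖ * ‖w s‖)
        dsimp only
        linarith
    _ = 2 * ‖P.B‖ ^ 2 * (∫ s in Ioo 0 T, ‖u s‖ ^ 2) +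
        2 * ‖P.a‖ ^ 2 * ∫ s in Ioo 0 T, ‖w s‖ ^ 2 := by
        rw [integral_add i1 i2, integral_const_mul, integral_const_mul]
    _ ≤ _ := by
        have h3 : ∫ s in Ioo 0 T, ‖u s‖ ^ 2 ≤ M ^ 2 * T₀ :=
          h2.trans (mul_le_mul_of_nonneg_left hT.2 (sq_nonneg M))
        gcongr

/-- If the target is reachable in times arbitrarily close to `T` from above, it is reachable in
time `T`. -/
theorem exists_reaches_of_forall_exists [CompleteSpace V] [CompleteSpace H]
    (hdense : DenseRange P.ι)
    (hgarding : ∃ α₀ > (0 : ℝ), ∃ ω₀ ≥ (0 : ℝ), ∀ v : V,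
      α₀ * ‖v‖ ^ 2 ≤ P.a v v + ω₀ * ‖P.ι v‖ ^ 2)
    (hbdd : Bornology.IsBounded P.Uad) {δ T : ℝ} (hT : 0 ≤ T)
    (h : ∀ ε > 0, ∃ S, T ≤ S ∧ S ≤ T + ε ∧ ∃ y, P.Reaches δ S y) : ∃ y, P.Reaches δ T y := by
  obtain ⟨K, hK0, hK⟩ := exists_forall_sqrt_velocity_le hgarding hbdd P.y₀
    (by positivity : 0 ≤ T + 1)
  have hne : ∀ ε > 0, (P.almostReaching T (P.δ₀ + δ) ε).Nonempty := by
    intro ε hε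
    -- The `1` keeps `S` in the range where `K` applies; the square makes `√(S - T) * K` at most
    -- `ε`.
    obtain ⟨S, hTS, hS, y, ⟨u, hu, hst⟩, hyS⟩ := h (min 1 ((ε / K) ^ 2)) (by positivity)
    obtain ⟨w, hw⟩ := hst.exists_isTrajectory
    have huT := hu.mono hTS
    have hwT := hw.mono hTS
    refine ⟨(hwT.memLp.toLp w, huT.1.toLp u, y S), ?_, hyS, y, ?_, ?_⟩
    · filter_upwards [huT.2, huT.1.coeFn_toLp] with t h1 h2
      change huT.1.toLp u t ∈ P.Uad
      rwa [h2]
    · exact hwT.congr (huT.1.coeFn_toLp.mono fun t ht => ht.symm)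
        (hwT.memLp.coeFn_toLp.mono fun t ht => ht.symm)
    · have h0 : (0 : ℝ) ∈ Icc 0 S := ⟨le_rfl, hT.trans hTS⟩
      have hTm : T ∈ Icc 0 S := ⟨hT, hTS⟩
      have hSm : S ∈ Icc 0 S := ⟨hT.trans hTS, le_rfl⟩
      have h1 : P.toDual (y T - y S) = -∫ s in T..S, P.velocity u w s := by
        rw [toDual_sub, hw.toDual_eq T hTm, hw.toDual_eq S hSm,
          ← intervalIntegral.integral_add_adjacent_intervals
            (intervalIntegrable_velocity hu.1 hw.memLp h0 hTm)
            (intervalIntegrable_velocity hu.1 hw.memLp hTm hSm)]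
        abel
      change ‖P.toDual (y T - y S)‖ ≤ ε
      rw [h1, norm_neg]
      have h2 := (memLp_velocity (P := P) hu.1 hw.memLp).norm_intervalIntegral_le hT hTS le_rfl
      have h3 := hK S u y w ⟨hT.trans hTS, hS.trans (by gcongr; exact min_le_left _ _)⟩ hu hw
      have h4 : √(S - T) ≤ ε / K := by
        rw [← Real.sqrt_sq (by positivity : 0 ≤ ε / K)]
        exact Real.sqrt_le_sqrt (by linarith [min_le_right 1 ((ε / K) ^ 2)])
      calc _ ≤ √(S - T) * √(∫ s in Ioo 0 S, ‖P.velocity u w s‖ ^ 2) := h2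
        _ ≤ ε / K * K := by gcongr
        _ = ε := div_mul_cancel₀ _ hK0.ne'
  obtain ⟨p, hp, hc⟩ := exists_cauchySeq_mem_of_antitone_prod
    (S := fun n : ℕ => P.almostReaching T (P.δ₀ + δ) (1 / ((n : ℝ) + 1)))
    (fun m n hmn => almostReaching_mono (Nat.one_div_le_one_div hmn))
    (fun n => convex_almostReaching) (fun n => hne _ Nat.one_div_pos_of_nat)
    (isBounded_almostReaching hgarding hbdd hT)
  obtain ⟨⟨w, u, k⟩, hlim⟩ := cauchySeq_tendsto_of_complete hc
  have hwl : Tendsto (fun n => (p n).1) atTop (𝓝 w) := (continuous_fst.tendsto _).comp hlim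
  have hul : Tendsto (fun n => (p n).2.1) atTop (𝓝 u) :=
    ((continuous_fst.comp continuous_snd).tendsto _).comp hlim
  have hkl : Tendsto (fun n => (p n).2.2) atTop (𝓝 k) :=
    ((continuous_snd.comp continuous_snd).tendsto _).comp hlim
  choose hU hr yn hyn hgap using hp
  obtain ⟨y, hy, hyl⟩ := exists_isTrajectory_of_tendsto hT hyn hwl hul
  have hUad : ∀ᵐ t ∂volume.restrict (Ioo 0 T), u t ∈ P.Uad := by
    obtain ⟨ns, -, hns⟩ := Lp.exists_subseq_tendsto_ae hul
    filter_upwards [hns, ae_all_iff.2 hU] with t h1 h2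
    exact isClosed_Uad.mem_of_tendsto h1 (Eventually.of_forall fun i => h2 (ns i))
  -- The gap tends to zero only in `V*`; density of the range of `ι` makes `toDual` injective, which
  -- gives equality in `H`.
  have hyk : y T = k := by
    refine sub_eq_zero.1 (eq_zero_of_toDual_eq_zero hdense (norm_eq_zero.1 ?_))
    have h1 : Tendsto (fun n => ‖P.toDual (yn n T - (p n).2.2)‖) atTop
        (𝓝 ‖P.toDual (y T - k)‖) :=
      ((continuous_toDual.tendsto _).comp ((hyl T ⟨hT, le_rfl⟩).sub hkl)).norm
    refine tendsto_nhds_unique h1 ?_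
    exact squeeze_zero (fun _ => norm_nonneg _) hgap tendsto_one_div_add_atTop_nhds_zero_nat
  refine ⟨y, ⟨u, ⟨Lp.memLp u, hUad⟩, hy.isState (Lp.memLp u)⟩, ?_⟩
  rw [hyk]
  exact le_of_tendsto (hkl.sub_const P.yd).norm (Eventually.of_forall hr)

theorem Reaches.mono {δ δ' T : ℝ} {y : ℝ → H} (h : P.Reaches δ T y) (hδ : δ ≤ δ') :
    P.Reaches δ' T y :=
  ⟨h.1, h.2.trans (by gcongr)⟩

theorem Reaches.minTime_le {δ T : ℝ} {y : ℝ → H} (h : P.Reaches δ T y) (hT : 0 < T) :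
    P.minTime δ ≤ ENNReal.ofReal T :=
  iInf₂_le T ⟨hT, y, h⟩

theorem antitone_minTime : Antitone P.minTime := fun _ _ h =>
  le_iInf₂ fun _ ⟨hT, _, hy⟩ => (hy.mono h).minTime_le hT

/-- Finiteness of the infimum yields reaching times just above it, and closedness in time does the
rest. The case of infimum `0` is included. -/
theorem exists_isOptimalTrajectory [CompleteSpace V] [CompleteSpace H]
    (hdense : DenseRange P.ι)
    (hgarding : ∃ α₀ > (0 : ℝ), ∃ ω₀ ≥ (0 : ℝ), ∀ v : V,
      α₀ * ‖v‖ ^ 2 ≤ P.a v v + ω₀ * ‖P.ι v‖ ^ 2)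
    (hbdd : Bornology.IsBounded P.Uad) {δ : ℝ} (hfin : P.minTime δ ≠ ∞) :
    ∃ T y, P.IsOptimalTrajectory δ T y := by
  obtain ⟨y, hy⟩ := exists_reaches_of_forall_exists (δ := δ) hdense hgarding hbdd
    (ENNReal.toReal_nonneg (a := P.minTime δ)) fun ε hε => by
      have h1 : P.minTime δ < P.minTime δ + ENNReal.ofReal ε :=
        ENNReal.lt_add_right hfin (by simpa using hε)
      obtain ⟨S, h3⟩ := iInf_lt_iff.1 h1
      obtain ⟨⟨hS, y, hy⟩, hlt⟩ := iInf_lt_iff.1 h3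
      refine ⟨S, ENNReal.toReal_le_of_le_ofReal hS.le (hy.minTime_le hS), ?_, y, hy⟩
      have h2 := hlt.le
      rw [← ENNReal.ofReal_toReal hfin, ← ENNReal.ofReal_add ENNReal.toReal_nonneg hε.le] at h2
      exact (ENNReal.ofReal_le_ofReal_iff (by positivity)).1 h2
  exact ⟨_, y, ENNReal.toReal_nonneg, ENNReal.ofReal_toReal hfin, hy⟩

/-- If a trajectory enters the open ball of radius `δ₀ + δ` then `T(δ')` is at most the entrance
time for some `δ' < δ`. -/
theorem exists_minTime_le_of_norm_lt {δ T : ℝ} {u : ℝ → Lp ℝ 2 ϱ} {y : ℝ → H} (hT : 0 < T)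
    (hu : P.IsAdmissible T u) (hy : P.IsState T u P.y₀ y) (hlt : ‖y T - P.yd‖ < P.δ₀ + δ) :
    ∃ δ' < δ, P.minTime δ' ≤ ENNReal.ofReal T :=
  ⟨‖y T - P.yd‖ - P.δ₀, by linarith,
    Reaches.minTime_le (y := y) ⟨⟨u, hu, hy⟩, by linarith⟩ hT⟩

end ControlProblem

/-! ### Left-continuity of the value function. -/

theorem mainTheorem4 {V H ω : Type*}
    [NormedAddCommGroup V] [InnerProductSpace ℝ V] [CompleteSpace V]
    [NormedAddCommGroup H] [InnerProductSpace ℝ H] [CompleteSpace H]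
    [MeasurableSpace ω] {ϱ : Measure ω} (P : ControlProblem V H ϱ)
    -- Gelfand triple with compact embedding
    (hinj : Function.Injective P.ι) (hdense : DenseRange P.ι) (hcomp : IsCompactOperator P.ι)
    -- Gårding inequality
    (hgarding : ∃ α₀ > (0 : ℝ), ∃ ω₀ ≥ (0 : ℝ), ∀ v : V,
      α₀ * ‖v‖ ^ 2 ≤ P.a v v + ω₀ * ‖P.ι v‖ ^ 2)
    -- control bounds and target radius
    (hab : ∀ᵐ x ∂ϱ, P.ua x < P.ub x) (hbdd : Bornology.IsBounded P.Uad) (hδ₀ : 0 < P.δ₀)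
    -- the target is reachable, and not reached at the initial time
    (hfeas : ∃ T > (0 : ℝ), ∃ y, P.Reaches 0 T y) (hout : P.δ₀ < ‖P.y₀ - P.yd‖)
    (hcontr : P.Controllability) :
    ∀ δ : ℝ, 0 < δ → ContinuousWithinAt P.minTime (Icc 0 δ) δ := by
  intro δ hδ
  have key : ∀ b, P.minTime δ < b → ∃ δ' < δ, P.minTime δ' < b := by
    intro b hb
    rcases le_or_gt δ (‖P.y₀ - P.yd‖ - P.δ₀) with hle | hgt
    · have hfin : P.minTime δ ≠ ∞ := by
        obtain ⟨T, hT, y, hy⟩ := hfeas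
        exact (((hy.mono hδ.le).minTime_le hT).trans_lt ENNReal.ofReal_lt_top).ne
      obtain ⟨T, y, ⟨hT, hTeq, ⟨u, hu, hy⟩, -⟩, T', hT', v, hv, z, hz, hlt⟩ :=
        hcontr δ ⟨hδ, hle⟩ (ControlProblem.exists_isOptimalTrajectory hdense hgarding hbdd hfin)
      obtain ⟨w, hw⟩ := hy.exists_isTrajectory
      obtain ⟨w', hw'⟩ := hz.exists_isTrajectory
      have hcont : Tendsto (fun t => ENNReal.ofReal (T + t)) (𝓝[>] 0) (𝓝 (P.minTime δ)) := by
        have h1 : Continuous fun t : ℝ => ENNReal.ofReal (T + t) :=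
          ENNReal.continuous_ofReal.comp (continuous_const.add continuous_id)
        have h2 := h1.tendsto 0
        rw [add_zero, hTeq] at h2
        exact h2.mono_left nhdsWithin_le_nhds
      obtain ⟨t, htb, ht⟩ :=
        -- The extra time `t` must keep `T + t` below `b` and stay in the window `(0, T']` of strict
        -- interiority. Its positivity also covers `T = 0`.
        ((hcont.eventually (gt_mem_nhds hb)).and (Ioc_mem_nhdsGT hT')).exists
      have hcat := hw.concat hT ht.1.le (hw'.mono ht.2) hu.1 (hv.mono ht.2).1
      have hadm := hu.concat (hv.mono ht.2)
      obtain ⟨δ', h1, h2⟩ := ControlProblem.exists_minTime_le_of_norm_lt (δ := δ) (by linarith [ht.1]) hadm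
        (hcat.isState hadm.1) (by
          rw [if_neg (by linarith [ht.1]), add_sub_cancel_left]
          exact hlt t ht)
      exact ⟨δ', h1, h2.trans_lt htb⟩
    -- Here `y₀` is in the open ball. The feasible trajectory serves only as some admissible motion
    -- near time `0`, where continuity keeps it in that ball.
    · obtain ⟨T, hT, y, ⟨u, hu, hy⟩, -⟩ := hfeas
      obtain ⟨w, hw⟩ := hy.exists_isTrajectory
      have h0 : (0 : ℝ) ∈ Icc 0 T := ⟨le_rfl, hT.le⟩
      have h1 : ContinuousWithinAt (fun t => ‖y t - P.yd‖) (Icc 0 T) 0 :=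
        ((hw.continuousOn 0 h0).sub continuousWithinAt_const).norm
      have hmem : Icc 0 T ∈ 𝓝[>] (0 : ℝ) :=
        mem_of_superset (Ioo_mem_nhdsGT hT) Ioo_subset_Icc_self
      have h2 := h1.mono_of_mem_nhdsWithin hmem
      have h3 : ∀ᶠ t in 𝓝[>] (0 : ℝ), ‖y t - P.yd‖ < P.δ₀ + δ :=
        h2.eventually (gt_mem_nhds (by simp only [hw.init]; linarith))
      have h4 : Tendsto ENNReal.ofReal (𝓝[>] (0 : ℝ)) (𝓝 0) := by
        have := ENNReal.continuous_ofReal.tendsto 0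
        rw [ENNReal.ofReal_zero] at this
        exact this.mono_left nhdsWithin_le_nhds
      have h5 := h4.eventually (gt_mem_nhds (zero_le.trans_lt hb))
      obtain ⟨t, ⟨ht3, ht5⟩, ht⟩ := ((h3.and h5).and (Ioc_mem_nhdsGT hT)).exists
      have hadm := hu.mono ht.2
      obtain ⟨δ', h6, h7⟩ := ControlProblem.exists_minTime_le_of_norm_lt ht.1 hadm
        ((hw.mono ht.2).isState hadm.1) ht3
      exact ⟨δ', h6, h7.trans_lt ht5⟩
  refine tendsto_order.2 ⟨fun b hb => ?_, fun b hb => ?_⟩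
  · filter_upwards [self_mem_nhdsWithin] with δ' hδ'
    exact hb.trans_le (ControlProblem.antitone_minTime hδ'.2)
  · obtain ⟨δ', hδ', hlt⟩ := key b hb
    -- The witness `δ'` may be negative; only `δ' < δ''` and monotonicity over all reals matter.
    filter_upwards [nhdsWithin_le_nhds (Ioi_mem_nhds hδ')] with δ'' h
    exact (ControlProblem.antitone_minTime (le_of_lt h)).trans_lt hlt
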